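/- Let $P$ be a monoid and $A$ a non-empty set, and let $\delta \colon A \times P \to P \times A$, $(a,p) \mapsto (p|_a,\, a \star p)$, be a self-similar action of $P$ on $A$: that is, $a \star 1 = a$, $a \star (pq) = (a\star p)\star q$, $1|_a = 1$ and $(pq)|_a = p|_a\, q|_{a \star p}$ for all $a \in A$ and $p,q\in P$. Extend it to the free monoid $A^*$ by $p|_{\epsilon} = p$, $p|_{aw} = (p|_w)|_a$, $\epsilon\star p = \epsilon$ and $(aw)\star p = (a \star p|_w)(w \star p)$ for $a \in A$ and $w \in A^*$, and suppose that $\delta$ is faithful, i.e., that the right action $\star$ of $P$ on $A^*$ is faithful. Let $\mathcal N_\delta$ be the variety of Nekrashevych $\delta$-algebras: left $P$-sets $X$ endowed with an isomorphism of $P$-sets $X \cong X^A$, where $P$ acts on $X^A$ by $(p\cdot\varphi)(a) = p|_a\cdot\varphi(a\star p)$; its homomorphisms are the functions that preserve both the $P$-action and the isomorphism. Then the following are equivalent: (a) the theory of Nekrashevych $\delta$-algebras is groupoidal, i.e., $\mathcal N_\delta$ is concretely equivalent over $\mathbf{Set}$ to the variety of algebras of a non-degenerate Grothendieck matched pair of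 algebras $(B_{\mathcal J}, M)$ whose classifying localic category is a groupoid. Here $B_{\mathcal J}$ is a Boolean algebra with $0\neq 1$ and a zero-dimensional topology $\mathcal J$ of partitions, $M$ is a monoid acting on $B_{\mathcal J}$ by Grothendieck Boolean homomorphisms $m^*$, with a compatible $B_{\mathcal J}$-set structure on $M$, and the algebras are the sets with compatible $B_{\mathcal J}$-set and left $M$-set structures. The classifying localic category has as locale of objects the $\mathcal J$-closed ideals of $B$, and as locale of arrows the $B_{\mathcal J}$-set homomorphisms $f\colon M\to \mathrm{Idl}_{\mathcal J}(B)$; the inverse images along source, target, identities and composition are $I \mapsto \lambda m.\, I$, $I\mapsto \lambda m.\, m^*I$, $f\mapsto f(1)$ and $f\mapsto \lambda m, n.\, f(mn)$, where $m^*I$ is the $\mathcal J$-closed ideal generated by the $m^*b$ with $b\in I$; (b) for each $p\in P$ there is a dense left ideal $I \leqslant A^*$ such that $p|_w$ is invertible in $P$ for every $w \in I$. (A left ideal $K\leqslant A^*$ is closed if $w \in K$ whenever $aw\in K$ for all $a\in A$; $I$ is dense if the only closed left ideal containing it is $A^*$.); (c) the forgetful functor $\mathcal N_\delta\to\mathcal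 N_{\delta'}$ is an isomorphism of categories, where $\delta' \colon A\times G\to G\times A$ is the restriction of $\delta$ to the group $G$ of invertible elements of $P$. -/

import Mathlib

open CategoryTheory

universe u

namespace Nekrashevych

/-! ### Grothendieck Boolean algebras -/

/-- `P` is a partition of `b`: a set of nonzero, pairwise disjoint elements with join `b`. -/
structure IsPartition {B : Type u} [BooleanAlgebra B] (P : Set B) (b : B) : Prop where
  ne_bot : ∀ c ∈ P, c ≠ ⊥
  disjoint : ∀ c ∈ P, ∀ d ∈ P, c ≠ d → c ⊓ d = ⊥
  isLUB : IsLUB P b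

/-- A zero-dimensional topology on a Boolean algebra: a collection of partitions of `⊤` containing
the finite ones, closed under refinement and under coarsening. A Grothendieck Boolean algebra is a
Boolean algebra with such a topology. -/
structure ZeroDimTopology (B : Type u) [BooleanAlgebra B] where
  parts : Set (Set B)
  isPartition : ∀ P ∈ parts, IsPartition P ⊤
  finite_mem : ∀ P : Set B, P.Finite → IsPartition P ⊤ → P ∈ parts
  refine_mem : ∀ P ∈ parts, ∀ Q : B → Set B, (∀ b ∈ P, Q b ∈ parts) →
    {d : B | d ≠ ⊥ ∧ ∃ b ∈ P, ∃ c ∈ Q b, b ⊓ c = d} ∈ parts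
  coarsen_mem : ∀ P ∈ parts, ∀ (I : Type u) (α : P → I), Function.Surjective α →
    ∃ j : I → B, (∀ i, IsLUB (Subtype.val '' (α ⁻¹' {i})) (j i)) ∧ Set.range j ∈ parts

/-- The partitions `P` of `b` that belong to the topology: those with join `b` contained in a
partition of `⊤` that belongs to the topology. -/
def ZeroDimTopology.PartOf {B : Type u} [BooleanAlgebra B] (J : ZeroDimTopology B)
    (b : B) (P : Set B) : Prop :=
  (∃ Q ∈ J.parts, P ⊆ Q) ∧ IsLUB P b

/-- The structure of a `B_J`-set on `X`: conditioned disjunction `cond b x y`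
("if `b` then `x` else `y`") together with the infinitary operation `glue P` for
every infinite partition `P` of the topology. -/
structure BJStructure {B : Type u} [BooleanAlgebra B] (J : ZeroDimTopology B) (X : Type u) where
  cond : B → X → X → X
  cond_self : ∀ b x, cond b x x = x
  cond_left : ∀ b x y z, cond b (cond b x y) z = cond b x z
  cond_right : ∀ b x y z, cond b x (cond b y z) = cond b x z
  cond_top : ∀ x y, cond ⊤ x y = x
  cond_compl : ∀ b x y, cond bᶜ x y = cond b y x
  cond_inf : ∀ b c x y, cond (b ⊓ c) x y = cond b (cond c x y) y
  glue : ∀ P : Set B, P ∈ J.parts → P.Infinite → (P → X) → X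
  glue_const : ∀ (P : Set B) hP hi x, glue P hP hi (fun _ => x) = x
  glue_cond : ∀ (P : Set B) hP hi (x y : P → X),
    glue P hP hi (fun b => cond b (x b) (y b)) = glue P hP hi x
  cond_glue : ∀ (P : Set B) hP hi (x : P → X) (b : P), cond b (glue P hP hi x) (x b) = x b

/-- The relation `x ≡_b y`, read "if `b` then `x = y`". -/
def BJStructure.Rel {B : Type u} [BooleanAlgebra B] {J : ZeroDimTopology B} {X : Type u}
    (S : BJStructure J X) (b : B) (x y : X) : Prop :=
  S.cond b x y = y

/-! ### Grothendieck matched pairs of algebras and their variety of algebras -/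

/-- The structure of a (non-degenerate) Grothendieck matched pair of algebras on a Boolean algebra
`B` and a monoid `M`; `star m` is the action `b ↦ m^* b` of `m` on `B`. -/
structure MatchedPair (B M : Type u) [BooleanAlgebra B] [Monoid M] where
  nondegenerate : (⊥ : B) ≠ ⊤
  J : ZeroDimTopology B
  bj : BJStructure J M
  star : M → BoundedLatticeHom B B
  star_one : ∀ b, star 1 b = b
  star_mul : ∀ m n b, star (m * n) b = star m (star n b)
  star_mem : ∀ m, ∀ P ∈ J.parts, {d : B | d ≠ ⊥ ∧ ∃ b ∈ P, star m b = d} ∈ J.parts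
  cond_mul : ∀ b m n p, bj.cond b m n * p = bj.cond b (m * p) (n * p)
  mul_cond : ∀ m b n p, m * bj.cond b n p = bj.cond (star m b) (m * n) (m * p)
  cond_star : ∀ b m n c, star (bj.cond b m n) c = (b ⊓ star m c) ⊔ (bᶜ ⊓ star n c)

variable {B M : Type u} [BooleanAlgebra B] [Monoid M]

/-- An algebra for a matched pair: a set with compatible `B_J`-set and left `M`-set structures. -/
structure BMSet (D : MatchedPair B M) where
  carrier : Type u
  [action : MulAction M carrier]
  bj : BJStructure D.J carrier
  cond_smul : ∀ b (m n : M) (x : carrier), D.bj.cond b m n • x = bj.cond b (m • x) (n • x)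
  smul_cond : ∀ (m : M) b (x y : carrier),
    m • bj.cond b x y = bj.cond (D.star m b) (m • x) (m • y)

attribute [instance] BMSet.action

/-- Homomorphisms preserve all the operations. -/
@[ext]
structure BMSet.Hom {D : MatchedPair B M} (X Y : BMSet D) where
  toFun : X.carrier → Y.carrier
  map_smul : ∀ (m : M) x, toFun (m • x) = m • toFun x
  map_cond : ∀ b x y, toFun (X.bj.cond b x y) = Y.bj.cond b (toFun x) (toFun y)
  map_glue : ∀ (P : Set B) hP hi x,
    toFun (X.bj.glue P hP hi x) = Y.bj.glue P hP hi (fun b => toFun (x b))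

instance (D : MatchedPair B M) : Category (BMSet D) where
  Hom X Y := BMSet.Hom X Y
  id X := ⟨id, fun _ _ => rfl, fun _ _ _ => rfl, fun _ _ _ _ => rfl⟩
  comp f g := ⟨g.toFun ∘ f.toFun,
    fun m x => by simp [f.map_smul, g.map_smul],
    fun b x y => by simp [f.map_cond, g.map_cond],
    fun P hP hi x => by simp [f.map_glue, g.map_glue]⟩

/-- The underlying-set functor on the variety of algebras of a matched pair. -/
def BMSet.forget (D : MatchedPair B M) : BMSet D ⥤ Type u where
  obj X := X.carrier
  map f := ↾f.toFun

/-! ### The classifying localic category -/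

/-- A `J`-closed ideal of `B`. -/
@[ext]
structure Idl (J : ZeroDimTopology B) where
  carrier : Set B
  bot_mem : ⊥ ∈ carrier
  sup_mem : ∀ b ∈ carrier, ∀ c ∈ carrier, b ⊔ c ∈ carrier
  lower : ∀ b ∈ carrier, ∀ c ≤ b, c ∈ carrier
  closed : ∀ b P, J.PartOf b P → P ⊆ carrier → b ∈ carrier

instance (J : ZeroDimTopology B) : SetLike (Idl J) B where
  coe := Idl.carrier
  coe_injective _ _ h := Idl.ext h

instance (J : ZeroDimTopology B) : PartialOrder (Idl J) := .ofSetLike (Idl J) B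

instance (J : ZeroDimTopology B) : InfSet (Idl J) where
  sInf S :=
    { carrier := {b | ∀ I ∈ S, b ∈ I}
      bot_mem := fun I _ => I.bot_mem
      sup_mem := fun _ hb _ hc I hI => I.sup_mem _ (hb I hI) _ (hc I hI)
      lower := fun _ hb _ hc I hI => I.lower _ (hb I hI) _ hc
      closed := fun b P hP h I hI => I.closed b P hP fun c hc => h hc I hI }

/-- The locale `Idl_J(B)` of `J`-closed ideals, ordered by inclusion. -/
instance (J : ZeroDimTopology B) : CompleteLattice (Idl J) :=
  completeLatticeOfInf (Idl J) fun _ =>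
    ⟨fun _ hI _ hb => hb _ hI, fun _ hK _ hb I hI => hK hI hb⟩

/-- `I ≡_b K` for `J`-closed ideals: `I ∩ ↓b = K ∩ ↓b`. -/
def Idl.Rel {J : ZeroDimTopology B} (b : B) (I K : Idl J) : Prop :=
  ∀ c ≤ b, (c ∈ I ↔ c ∈ K)

/-- The `J`-closed ideal of the `d` with `a ⊓ d ∈ I`. -/
def Idl.residual {J : ZeroDimTopology B} (a : B) (I : Idl J) : Idl J where
  carrier := {d | a ⊓ d ∈ I}
  bot_mem := by
    change a ⊓ ⊥ ∈ I.carrier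
    simpa using I.bot_mem
  sup_mem b hb c hc := by
    have := I.sup_mem _ hb _ hc
    rwa [← inf_sup_left] at this
  lower b hb c hc := I.lower _ hb _ (inf_le_inf_left a hc)
  closed d P := by
    rintro ⟨⟨Q, hQ, hPQ⟩, hlub⟩ hP
    have hT : {x : B | x ≠ ⊥ ∧ (x = a ∨ x = aᶜ)} ∈ J.parts := by
      refine J.finite_mem _ ?_ ⟨fun c hc => hc.1, ?_, ?_⟩
      · exact (Set.toFinite {a, aᶜ}).subset fun x hx => by simpa using hx.2
      · rintro c ⟨_, rfl | rfl⟩ e ⟨_, rfl | rfl⟩ h <;> simp at h ⊢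
      · refine ⟨fun _ _ => le_top, fun t ht => ?_⟩
        have h1 : a ≤ t := by
          by_cases h : a = ⊥
          · simp [h]
          · exact ht ⟨h, Or.inl rfl⟩
        have h2 : aᶜ ≤ t := by
          by_cases h : aᶜ = ⊥
          · simp [h]
          · exact ht ⟨h, Or.inr rfl⟩
        simpa using sup_le h1 h2
    have hR := J.refine_mem Q hQ (fun _ => {x : B | x ≠ ⊥ ∧ (x = a ∨ x = aᶜ)}) fun _ _ => hT
    refine I.closed (a ⊓ d) {x | x ≠ ⊥ ∧ ∃ p ∈ P, a ⊓ p = x} ⟨⟨_, hR, ?_⟩, ?_, ?_⟩ ?_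
    · rintro x ⟨hx, p, hp, rfl⟩
      refine ⟨hx, p, hPQ hp, a, ⟨?_, Or.inl rfl⟩, inf_comm _ _⟩
      rintro rfl
      simp at hx
    · rintro x ⟨_, p, hp, rfl⟩
      exact inf_le_inf_left a (hlub.1 hp)
    · intro t ht
      rw [inf_comm, ← le_himp_iff]
      refine hlub.2 fun p hp => ?_
      rw [le_himp_iff, inf_comm]
      by_cases h : a ⊓ p = ⊥
      · simp [h]
      · exact ht ⟨h, p, hp, rfl⟩
    · rintro x ⟨_, p, hp, rfl⟩
      exact hP hp

namespace MatchedPair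

variable (D : MatchedPair B M)

/-- `m^* I`: the `J`-closed ideal generated by the elements `m^* b` with `b ∈ I`. -/
def pull (m : M) (I : Idl D.J) : Idl D.J :=
  sInf {K | ∀ b ∈ I, D.star m b ∈ K}

theorem star_mem_pull (m : M) (I : Idl D.J) {b : B} (hb : b ∈ I) : D.star m b ∈ D.pull m I :=
  fun _ hK => hK b hb

theorem pull_rel_left {b : B} {m n : M} (h : D.bj.Rel b m n) (I : Idl D.J) :
    Idl.Rel b (D.pull m I) (D.pull n I) := by
  have key : ∀ e, b ⊓ D.star m e = b ⊓ D.star n e := by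
    intro e
    have := D.cond_star b m n e
    rw [show D.bj.cond b m n = n from h] at this
    rw [this, inf_sup_left]
    simp [← inf_assoc]
  have aux : ∀ m n : M, (∀ e, b ⊓ D.star m e = b ⊓ D.star n e) → ∀ c ≤ b,
      c ∈ D.pull m I → c ∈ D.pull n I := by
    intro m n key c hc hm
    have h1 : c ∈ Idl.residual b (D.pull n I) := hm _ fun e he => by
      change b ⊓ D.star m e ∈ D.pull n I
      rw [key]
      exact Idl.lower _ _ (D.star_mem_pull n I he) _ inf_le_right
    have h2 : b ⊓ c ∈ D.pull n I := h1
    rwa [inf_eq_right.2 hc] at h2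
  exact fun c hc => ⟨aux m n key c hc, aux n m (fun e => (key e).symm) c hc⟩

theorem pull_rel_right {b : B} (m : M) {I K : Idl D.J} (h : Idl.Rel b I K) :
    Idl.Rel (D.star m b) (D.pull m I) (D.pull m K) := by
  have aux : ∀ I K : Idl D.J, Idl.Rel b I K → ∀ c ≤ D.star m b,
      c ∈ D.pull m I → c ∈ D.pull m K := by
    intro I K h c hc hm
    have h1 : c ∈ Idl.residual (D.star m b) (D.pull m K) := hm _ fun e he => by
      change D.star m b ⊓ D.star m e ∈ D.pull m K
      rw [← map_inf]
      exact D.star_mem_pull m K ((h _ inf_le_left).1 (I.lower _ he _ inf_le_right))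
    have h2 : D.star m b ⊓ c ∈ D.pull m K := h1
    rwa [inf_eq_right.2 hc] at h2
  exact fun c hc => ⟨aux I K h c hc, aux K I (fun e he => (h e he).symm) c hc⟩

/-- The locale of objects. -/
abbrev C₀ : Type u := Idl D.J

/-- The locale of arrows: the homomorphisms of `B_J`-sets `M → Idl_J(B)` (that is, the functions
preserving each relation `≡_b`), ordered pointwise. -/
@[ext]
structure C₁ : Type u where
  toFun : M → Idl D.J
  rel : ∀ b m n, D.bj.Rel b m n → Idl.Rel b (toFun m) (toFun n)

/-- The locale of composable pairs `C₁ ×_{C₀} C₁`: the functions `f : M × M → Idl_J(B)` with each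
`f (-, n)` a homomorphism to `Idl_J(B)` and each `f (m, -)` a homomorphism to `m^* Idl_J(B)`,
ordered pointwise. The pair `(m, n)` stands for `m` followed by `n`. -/
@[ext]
structure C₂ : Type u where
  toFun : M → M → Idl D.J
  rel_left : ∀ n b m m', D.bj.Rel b m m' → Idl.Rel b (toFun m n) (toFun m' n)
  rel_right : ∀ m b n n', D.bj.Rel b n n' → Idl.Rel (D.star m b) (toFun m n) (toFun m n')

instance : PartialOrder D.C₁ := PartialOrder.lift C₁.toFun fun _ _ => C₁.ext

instance : PartialOrder D.C₂ := PartialOrder.lift C₂.toFun fun _ _ => C₂.ext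

instance : InfSet D.C₁ where
  sInf S :=
    { toFun := fun m => sInf {I | ∃ f ∈ S, f.toFun m = I}
      rel := fun b m n h c hc => by
        constructor
        · rintro hm _ ⟨f, hf, rfl⟩
          exact (f.rel b m n h c hc).1 (hm _ ⟨f, hf, rfl⟩)
        · rintro hm _ ⟨f, hf, rfl⟩
          exact (f.rel b m n h c hc).2 (hm _ ⟨f, hf, rfl⟩) }

instance : InfSet D.C₂ where
  sInf S :=
    { toFun := fun m n => sInf {I | ∃ f ∈ S, f.toFun m n = I}
      rel_left := fun n b m m' h c hc => by
        constructor
        · rintro hm _ ⟨f, hf, rfl⟩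
          exact (f.rel_left n b m m' h c hc).1 (hm _ ⟨f, hf, rfl⟩)
        · rintro hm _ ⟨f, hf, rfl⟩
          exact (f.rel_left n b m m' h c hc).2 (hm _ ⟨f, hf, rfl⟩)
      rel_right := fun m b n n' h c hc => by
        constructor
        · rintro hm _ ⟨f, hf, rfl⟩
          exact (f.rel_right m b n n' h c hc).1 (hm _ ⟨f, hf, rfl⟩)
        · rintro hm _ ⟨f, hf, rfl⟩
          exact (f.rel_right m b n n' h c hc).2 (hm _ ⟨f, hf, rfl⟩) }

instance : CompleteLattice D.C₁ :=
  completeLatticeOfInf D.C₁ fun _ =>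
    ⟨fun f hf m _ hb => hb (f.toFun m) ⟨f, hf, rfl⟩, fun _ hg m b hb => by
      rintro _ ⟨f, hf, rfl⟩
      exact hg hf m hb⟩

instance : CompleteLattice D.C₂ :=
  completeLatticeOfInf D.C₂ fun _ =>
    ⟨fun f hf m n _ hb => hb (f.toFun m n) ⟨f, hf, rfl⟩, fun _ hg m n b hb => by
      rintro _ ⟨f, hf, rfl⟩
      exact hg hf m n hb⟩

/-- Inverse image along the source map `C₁ → C₀`. -/
def src (I : D.C₀) : D.C₁ where
  toFun _ := I
  rel _ _ _ _ _ _ := Iff.rfl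

/-- Inverse image along the target map `C₁ → C₀`. -/
def tgt (I : D.C₀) : D.C₁ where
  toFun m := D.pull m I
  rel _ _ _ h := D.pull_rel_left h I

/-- Inverse image along the identities map `C₀ → C₁`. -/
def ident (f : D.C₁) : D.C₀ := f.toFun 1

/-- Inverse image along the composition map `C₁ ×_{C₀} C₁ → C₁`. -/
def compos (f : D.C₁) : D.C₂ where
  toFun m n := f.toFun (m * n)
  rel_left n b m m' h := f.rel b _ _ (by
    rw [BJStructure.Rel, ← D.cond_mul, show D.bj.cond b m m' = m' from h])
  rel_right m b n n' h := f.rel _ _ _ (by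
    rw [BJStructure.Rel, ← D.mul_cond, show D.bj.cond b n n' = n' from h])

/-- Inverse image along the projection `C₁ ×_{C₀} C₁ → C₁` to the first arrow. -/
def fst (f : D.C₁) : D.C₂ where
  toFun m _ := f.toFun m
  rel_left _ b m m' h := f.rel b m m' h
  rel_right _ _ _ _ _ _ _ := Iff.rfl

/-- Inverse image along the projection `C₁ ×_{C₀} C₁ → C₁` to the second arrow. -/
def snd (f : D.C₁) : D.C₂ where
  toFun m n := D.pull m (f.toFun n)
  rel_left n _ _ _ h := D.pull_rel_left h (f.toFun n)
  rel_right m b n n' h := D.pull_rel_right m (f.rel b n n' h)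

/-- The classifying localic category is a groupoid: there is an inversion map of locales
`C₁ → C₁` satisfying the axioms of an internal groupoid. A map of locales is given by the frame
homomorphism in the opposite direction; `inv` is the one of inversion, and `l`, `r` are those of
the maps `⟨1, inv⟩` and `⟨inv, 1⟩` from `C₁` to `C₁ ×_{C₀} C₁`. -/
def IsLocalicGroupoid : Prop :=
  ∃ (inv : FrameHom D.C₁ D.C₁) (l r : FrameHom D.C₂ D.C₁),
    (∀ I, inv (D.src I) = D.tgt I) ∧
    (∀ I, inv (D.tgt I) = D.src I) ∧
    (∀ f, l (D.fst f) = f) ∧ (∀ f, l (D.snd f) = inv f) ∧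
    (∀ f, l (D.compos f) = D.src (D.ident f)) ∧
    (∀ f, r (D.fst f) = inv f) ∧ (∀ f, r (D.snd f) = f) ∧
    (∀ f, r (D.compos f) = D.tgt (D.ident f))

end MatchedPair

/-- A variety with underlying-set functor `U : C ⥤ Type u` is groupoidal: it is, concretely over
sets, the variety of algebras of a matched pair whose classifying localic category is a groupoid.
(The matched pair is determined up to isomorphism by the variety.) -/
def IsGroupoidal {C : Type*} [Category C] (U : C ⥤ Type u) : Prop :=
  ∃ (B M : Type u) (_ : BooleanAlgebra B) (_ : Monoid M) (D : MatchedPair B M),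
    (∃ E : C ≌ BMSet D, Nonempty (E.functor ⋙ BMSet.forget D ≅ U)) ∧ D.IsLocalicGroupoid

/-! ### Self-similar actions and Nekrashevych algebras -/

/-- A self-similar action of the monoid `P` on the set `A`: `res p a` is `p|_a` and `act a p` is
`a ⋆ p`, so that the action is the function `(a, p) ↦ (p|_a, a ⋆ p)`. -/
structure SelfSimilarAction (P A : Type u) [Monoid P] where
  res : P → A → P
  act : A → P → A
  act_one : ∀ a, act a 1 = a
  act_mul : ∀ a p q, act a (p * q) = act (act a p) q
  res_one : ∀ a, res 1 a = 1
  res_mul : ∀ p q a, res (p * q) a = res p a * res q (act a p)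

variable {P A : Type u} [Monoid P]

namespace SelfSimilarAction

variable (δ : SelfSimilarAction P A)

/-- The extension of `p|_a` to words. The word `a_n ⋯ a_1` is the list `[a_n, …, a_1]`, so that
letters are consumed from the end of the list. -/
def resWord (p : P) : List A → P
  | [] => p
  | a :: w => δ.res (resWord p w) a

/-- The extension of `a ⋆ p` to words. -/
def actWord (p : P) : List A → List A
  | [] => []
  | a :: w => δ.act a (δ.resWord p w) :: actWord p w

/-- The action is faithful if the action of `P` on the free monoid on `A` is. -/
def Faithful : Prop := ∀ p q : P, (∀ w, δ.actWord p w = δ.actWord q w) → p = q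

/-- The restriction of a self-similar action to the group of invertible elements of `P`. -/
def units : SelfSimilarAction Pˣ A where
  res p a :=
    { val := δ.res p a
      inv := δ.res (p⁻¹ : Pˣ) (δ.act a p)
      val_inv := by rw [← δ.res_mul, Units.mul_inv, δ.res_one]
      inv_val := by
        have h := δ.res_mul (p⁻¹ : Pˣ) p (δ.act a p)
        rw [← δ.act_mul, Units.mul_inv, δ.act_one, Units.inv_mul, δ.res_one] at h
        exact h.symm }
  act a p := δ.act a p
  act_one a := by simp [δ.act_one]
  act_mul a p q := by simp [δ.act_mul]
  res_one a := by ext; simp [δ.res_one]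
  res_mul p q a := by ext; simp [δ.res_mul]

/-- The set `X^A` for a left `P`-set `X`, with the left `P`-action
`(p • φ) a = p|_a • φ (a ⋆ p)`. -/
def Power (_ : SelfSimilarAction P A) (X : Type u) : Type u := A → X

instance (X : Type u) [MulAction P X] : MulAction P (δ.Power X) where
  smul p φ := fun a => δ.res p a • φ (δ.act a p)
  one_smul φ := by
    funext a
    change δ.res 1 a • φ (δ.act a 1) = φ a
    rw [δ.res_one, δ.act_one, one_smul]
  mul_smul p q φ := by
    funext a
    change δ.res (p * q) a • φ (δ.act a (p * q)) =
      δ.res p a • δ.res q (δ.act a p) • φ (δ.act (δ.act a p) q)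
    rw [δ.res_mul, δ.act_mul, mul_smul]

end SelfSimilarAction

/-- A Nekrashevych `δ`-algebra: a left `P`-set `X` with an isomorphism of `P`-sets `X ≅ X^A`. -/
structure Alg (δ : SelfSimilarAction P A) where
  carrier : Type u
  [action : MulAction P carrier]
  iso : carrier ≃ δ.Power carrier
  iso_smul : ∀ (p : P) x, iso (p • x) = p • iso x

attribute [instance] Alg.action

/-- Homomorphisms of Nekrashevych algebras. -/
@[ext]
structure Alg.Hom {δ : SelfSimilarAction P A} (X Y : Alg δ) where
  toFun : X.carrier → Y.carrier
  map_smul : ∀ (p : P) x, toFun (p • x) = p • toFun x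
  map_iso : ∀ x (a : A), Y.iso (toFun x) a = toFun (X.iso x a)

instance (δ : SelfSimilarAction P A) : Category (Alg δ) where
  Hom X Y := Alg.Hom X Y
  id X := ⟨id, fun _ _ => rfl, fun _ _ => rfl⟩
  comp f g := ⟨g.toFun ∘ f.toFun,
    fun p x => by simp [f.map_smul, g.map_smul],
    fun x a => by simp [f.map_iso, g.map_iso]⟩

/-- The underlying-set functor on the variety of Nekrashevych algebras. -/
def Alg.forget (δ : SelfSimilarAction P A) : Alg δ ⥤ Type u where
  obj X := X.carrier
  map f := ↾f.toFun

/-- The functor from `δ`-algebras to algebras for the restriction of `δ` to the group of invertible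
elements, which forgets the action of the non-invertible ones. -/
def Alg.toUnits (δ : SelfSimilarAction P A) : Alg δ ⥤ Alg δ.units where
  obj X :=
    { carrier := X.carrier
      iso := X.iso
      iso_smul := fun p x => X.iso_smul p x }
  map f := ⟨f.toFun, fun p x => f.map_smul p x, f.map_iso⟩

/-- A left ideal of the free monoid on `A`, words being written as lists. -/
def IsLeftIdeal (I : Set (List A)) : Prop := ∀ v, ∀ w ∈ I, v ++ w ∈ I

/-- A left ideal `I` is closed if `w ∈ I` whenever `aw ∈ I` for all letters `a`. -/
def IsClosedIdeal (I : Set (List A)) : Prop :=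
  IsLeftIdeal I ∧ ∀ w, (∀ a, a :: w ∈ I) → w ∈ I

/-- A left ideal is dense if the smallest closed ideal containing it is everything. -/
def IsDenseIdeal (I : Set (List A)) : Prop :=
  IsLeftIdeal I ∧ ∀ K, IsClosedIdeal K → I ⊆ K → K = Set.univ

end Nekrashevych

/-!
The implications are proved in a cycle.

*Groupoidal theories.* If the classifying localic category of a matched pair `(B_J, M)` is a
groupoid, then composing an arrow with its inverse gives an identity, so the open set of arrows
that are locally right invertible is everything: for each `m : M`, the `b : B` for which some `n`
satisfies `m * n ≡_b 1` generate the unit ideal (`IsLocalicGroupoid.exists_right_inverse`).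
Conversely, if every `m` is locally invertible, then inversion is patched together from local
inverses (`LocallyInvertible.isLocalicGroupoid`).

*From groupoidality to dense invertibility.* Suppose that the Nekrashevych algebras are the
algebras of `(B_J, M)`. An operation of Nekrashevych algebras is an element `t` of a free algebra,
and for a dense family of words `w` the component `t_w` is of the form `q • x_v` with `x` a
generator (`Alg.covers_reduced`). Applied to the operations of patching along partitions, this
shows that the members of a partition in `J` are decided at a dense family of words; applied to a
right inverse `n` of the operation `p • -` over `b`, it yields equations `p|_w • q • x_v = x_w`,
valid in all algebras, at a dense family of the words `w` where `b` holds. In the algebra of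
functions on streams, which carry an integer grading to record the length of `v`, such an equation
forces `p|_w q = 1` when the action is faithful. Thus all restrictions are densely right
invertible, and applying this to the right inverses makes them densely invertible
(`IsGroupoidal.covers_isUnit`).

*From dense invertibility to an isomorphism.* An element of a Nekrashevych algebra is determined
by, and can be patched from, its components at a dense family of words. As `(p • x)_w = p|_w •
x_{w ⋆ p}`, the action of `p` is determined by that of the invertible `p|_w`, and can be
reconstructed from it (`Alg.toUnits_isIso`).

*From an isomorphism to groupoidality.* It suffices to treat actions by groups. Here `B` is the
Boolean algebra of complemented closed left ideals of words (`Clopen`) and `M` the free algebra on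
one generator (`Endo`), which acts on `B` because `B` is itself a Nekrashevych algebra. The
algebras of this matched pair are the Nekrashevych algebras (`comparison`), and where `m_w = g •
1_v`, any `n` with `n_v = g⁻¹ • 1_w` is inverse to `m` between the cones of `w` and `v`
(`locallyInvertible_of_isUnit`).
-/

namespace Nekrashevych

/-! ### Conditional congruences in sets over a Grothendieck Boolean algebra -/

section BJSets

variable {B : Type u} [BooleanAlgebra B] {J : ZeroDimTopology B} {X : Type u}

namespace BJStructure

variable (S : BJStructure J X) {b c : B} {x y z : X}

theorem rel_refl (b : B) (x : X) : S.Rel b x x := S.cond_self b x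

variable {S}

theorem Rel.symm (h : S.Rel b x y) : S.Rel b y x := by
  have h' : S.cond b x y = y := h
  rw [Rel, ← h', S.cond_left, S.cond_self]

theorem Rel.trans (h : S.Rel b x y) (h' : S.Rel b y z) : S.Rel b x z := by
  have h1 : S.cond b x y = y := h
  rw [Rel, ← S.cond_left b x y z, h1]
  exact h'

theorem Rel.mono (h : S.Rel b x y) (hc : c ≤ b) : S.Rel c x y := by
  have h1 : S.cond b x y = y := h
  rw [Rel, ← inf_eq_left.2 hc, S.cond_inf, h1, S.cond_self]

theorem Rel.sup (h : S.Rel b x y) (h' : S.Rel c x y) : S.Rel (b ⊔ c) x y := by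
  have h1 : S.cond b x y = y := h
  have h2 : S.cond c x y = y := h'
  rw [Rel, ← compl_compl (b ⊔ c), S.cond_compl, compl_sup, S.cond_inf, S.cond_compl, S.cond_compl,
    h2, h1]

variable (S)

theorem rel_cond (b : B) (x y : X) : S.Rel b (S.cond b x y) x := by
  rw [Rel, S.cond_left, S.cond_self]

theorem rel_compl_cond (b : B) (x y : X) : S.Rel bᶜ (S.cond b x y) y := by
  rw [Rel, S.cond_compl, S.cond_right, S.cond_self]

theorem rel_bot (x y : X) : S.Rel ⊥ x y := by
  rw [Rel, ← compl_top, S.cond_compl, S.cond_top]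

variable {S}

theorem Rel.eq (h : S.Rel ⊤ x y) : x = y := by
  rw [← S.cond_top x y]
  exact h

theorem eq_of_rel_compl (h : S.Rel b x y) (h' : S.Rel bᶜ x y) : x = y := by
  refine Rel.eq (S := S) ?_
  rw [← sup_compl_eq_top (x := b)]
  exact h.sup h'

theorem eq_cond (h : S.Rel b z x) (h' : S.Rel bᶜ z y) : z = S.cond b x y :=
  eq_of_rel_compl (h.trans (S.rel_cond b x y).symm) (h'.trans (S.rel_compl_cond b x y).symm)

/-- An element is determined by its restrictions to the members of an infinite partition. -/
theorem eq_glue {P : Set B} {hP : P ∈ J.parts} {hi : P.Infinite} {f : P → X}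
    (h : ∀ b : P, S.Rel b z (f b)) : z = S.glue P hP hi f := by
  have h1 : (fun b : P => S.cond b z (f b)) = f := funext fun b => h b
  rw [← h1, S.glue_cond, S.glue_const]

theorem rel_glue {P : Set B} (hP : P ∈ J.parts) (hi : P.Infinite) (f : P → X) (b : P) :
    S.Rel b (S.glue P hP hi f) (f b) :=
  S.cond_glue P hP hi f b

theorem rel_finset_sup {ι : Type*} (s : Finset ι) (f : ι → B) (h : ∀ i ∈ s, S.Rel (f i) x y) :
    S.Rel (s.sup f) x y := by
  classical
  induction s using Finset.induction_on with
  | empty => exact S.rel_bot x y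
  | insert i s _ ih =>
    rw [Finset.sup_insert]
    exact (h i (by simp)).sup (ih fun j hj => h j (by simp [hj]))

end BJStructure

theorem finset_sup_of_isLUB {P : Set B} {b : B} (hP : IsLUB P b) (hf : P.Finite) :
    hf.toFinset.sup id = b := by
  refine le_antisymm (Finset.sup_le fun c hc => hP.1 (by simpa using hc)) (hP.2 fun c hc => ?_)
  exact Finset.le_sup (f := id) (by simpa using hc)

namespace BJStructure

variable {S : BJStructure J X}

theorem eq_of_rel_parts {P : Set B} (hP : P ∈ J.parts) {x y : X} (h : ∀ b ∈ P, S.Rel b x y) :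
    x = y := by
  by_cases hf : P.Finite
  · refine Rel.eq (S := S) ?_
    rw [← finset_sup_of_isLUB (J.isPartition P hP).isLUB hf]
    exact rel_finset_sup _ _ fun b hb => h b (by simpa using hb)
  · exact (S.eq_glue (hP := hP) (hi := hf) (f := fun _ => y) fun b => h b b.2).trans
      (S.glue_const P hP hf y)

/-- Elements can be patched along any partition of the topology, finite or not. -/
theorem exists_rel_parts [Nonempty X] {P : Set B} (hP : P ∈ J.parts) (f : P → X) :
    ∃ z, ∀ b : P, S.Rel b z (f b) := by
  classical
  by_cases hf : P.Finite
  · have key : ∀ s : Finset P, ∃ z, ∀ b ∈ s, S.Rel (b : B) z (f b) := by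
      intro s
      induction s using Finset.induction_on with
      | empty => exact ⟨Classical.arbitrary X, by simp⟩
      | insert i s his ih =>
        obtain ⟨z, hz⟩ := ih
        refine ⟨S.cond i (f i) z, fun b hb => ?_⟩
        obtain rfl | hb := Finset.mem_insert.1 hb
        · exact S.rel_cond _ _ _
        · have hd : (b : B) ≤ (i : B)ᶜ := by
            refine le_compl_iff_disjoint_right.2 (disjoint_iff.2 ?_)
            refine (J.isPartition P hP).disjoint _ b.2 _ i.2 fun h => his ?_
            rwa [← Subtype.ext h]
          exact ((S.rel_compl_cond _ _ _).mono hd).trans (hz b hb)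
    have := hf.fintype
    obtain ⟨z, hz⟩ := key Finset.univ
    exact ⟨z, fun b => hz b (Finset.mem_univ b)⟩
  · exact ⟨S.glue P hP hf f, S.rel_glue hP hf f⟩

end BJStructure

/-! ### Closed ideals of a Grothendieck Boolean algebra -/

namespace Idl

variable {I K L : Idl J} {b c : B}

theorem mem_sInf {T : Set (Idl J)} : b ∈ sInf T ↔ ∀ I ∈ T, b ∈ I := Iff.rfl

theorem mem_inf : b ∈ I ⊓ K ↔ b ∈ I ∧ b ∈ K := by
  refine ⟨fun h => ⟨inf_le_left (a := I) h, inf_le_right (a := I) h⟩, fun h => ?_⟩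
  rw [← sInf_pair, mem_sInf]
  rintro _ (rfl | rfl)
  exacts [h.1, h.2]

theorem mem_top : b ∈ (⊤ : Idl J) := by
  rw [← sInf_empty, mem_sInf]
  rintro _ ⟨⟩

theorem mem_sSup {T : Set (Idl J)} : b ∈ sSup T ↔ ∀ K : Idl J, (∀ I ∈ T, I ≤ K) → b ∈ K := by
  refine ⟨fun h K hK => sSup_le hK h, fun h => h _ fun I hI => le_sSup hI⟩

theorem mem_residual : c ∈ residual b I ↔ b ⊓ c ∈ I := Iff.rfl

theorem eq_top_of_mem (h : (⊤ : B) ∈ I) (b : B) : b ∈ I := I.lower _ h _ le_top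

variable (J) in
/-- The closed ideal generated by a set. -/
def gen (S : Set B) : Idl J := sInf {K | ∀ b ∈ S, b ∈ K}

theorem mem_gen {S : Set B} : c ∈ gen J S ↔ ∀ K : Idl J, (∀ b ∈ S, b ∈ K) → c ∈ K := Iff.rfl

theorem subset_gen {S : Set B} (h : b ∈ S) : b ∈ gen J S := fun _ hK => hK b h

theorem Rel.refl (b : B) (I : Idl J) : Rel b I I := fun _ _ => Iff.rfl

theorem Rel.symm (h : Rel b I K) : Rel b K I := fun c hc => (h c hc).symm

theorem Rel.trans (h : Rel b I K) (h' : Rel b K L) : Rel b I L :=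
  fun c hc => (h c hc).trans (h' c hc)

theorem Rel.mono (h : Rel b I K) (hc : c ≤ b) : Rel c I K := fun d hd => h d (hd.trans hc)

theorem Rel.inf {I' K' : Idl J} (h : Rel b I K) (h' : Rel b I' K') :
    Rel b (I ⊓ I') (K ⊓ K') := fun c hc => by
  rw [mem_inf, mem_inf, h c hc, h' c hc]

theorem Rel.sSup_image {ι : Type*} {T : Set ι} {f g : ι → Idl J} (h : ∀ i ∈ T, Rel b (f i) (g i)) :
    Rel b (sSup (f '' T)) (sSup (g '' T)) := by
  have aux : ∀ f g : ι → Idl J, (∀ i ∈ T, Rel b (f i) (g i)) → ∀ c ≤ b,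
      c ∈ sSup (f '' T) → c ∈ sSup (g '' T) := by
    intro f g h c hc hm
    have h1 : c ∈ residual b (sSup (g '' T)) := by
      refine mem_sSup.1 hm _ ?_
      rintro _ ⟨i, hi, rfl⟩ e he
      exact (le_sSup ⟨i, hi, rfl⟩ : g i ≤ sSup (g '' T))
        ((h i hi _ inf_le_left).1 ((f i).lower _ he _ inf_le_right))
    rw [mem_residual, inf_eq_right.2 hc] at h1
    exact h1
  exact fun c hc => ⟨aux f g h c hc, aux g f (fun i hi => (h i hi).symm) c hc⟩

/-- The conditional congruence on closed ideals is local over a covering family. -/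
theorem Rel.of_cover {S : Set B} (hS : (⊤ : B) ∈ gen J S) (h : ∀ c ∈ S, Rel (b ⊓ c) I K) :
    Rel b I K := by
  have aux : ∀ I K : Idl J, (∀ c ∈ S, Rel (b ⊓ c) I K) → ∀ c ≤ b, c ∈ I → c ∈ K := by
    intro I K h c hc hI
    have h1 : (⊤ : B) ∈ residual c K := mem_gen.1 hS _ fun d hd =>
      (h d hd _ (inf_le_inf_right d hc)).1 (I.lower _ hI _ inf_le_left)
    simpa [mem_residual] using h1
  exact fun c hc => ⟨aux I K h c hc, aux K I (fun d hd => (h d hd).symm) c hc⟩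

theorem eq_of_cover {S : Set B} (hS : (⊤ : B) ∈ gen J S) (h : ∀ c ∈ S, Rel c I K) : I = K := by
  have h1 : Rel ⊤ I K := .of_cover hS fun c hc => by simpa using h c hc
  exact SetLike.ext fun c => h1 c le_top

end Idl

end BJSets

/-! ### Algebras of a matched pair -/

namespace BMSet

variable {B M : Type u} [BooleanAlgebra B] [Monoid M] {D : MatchedPair B M}

theorem rel_smul_left (Y : BMSet D) {b : B} {m n : M} (h : D.bj.Rel b m n) (y : Y.carrier) :
    Y.bj.Rel b (m • y) (n • y) := by
  rw [BJStructure.Rel, ← Y.cond_smul, show D.bj.cond b m n = n from h]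

theorem rel_smul_right (Y : BMSet D) {b : B} (m : M) {x y : Y.carrier} (h : Y.bj.Rel b x y) :
    Y.bj.Rel (D.star m b) (m • x) (m • y) := by
  rw [BJStructure.Rel, ← Y.smul_cond, show Y.bj.cond b x y = y from h]

theorem Hom.map_rel {X Y : BMSet D} (f : BMSet.Hom X Y) {b : B} {x y : X.carrier}
    (h : X.bj.Rel b x y) : Y.bj.Rel b (f.toFun x) (f.toFun y) := by
  rw [BJStructure.Rel, ← f.map_cond, show X.bj.cond b x y = y from h]

variable (D) in
/-- The regular representation of a matched pair, which is its free algebra on one generator. -/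
@[reducible]
def regular : BMSet D where
  carrier := M
  bj := D.bj
  cond_smul := D.cond_mul
  smul_cond := D.mul_cond

/-- The homomorphism from the regular representation with a given value at `1`. -/
def orbit (Y : BMSet D) (y : Y.carrier) : BMSet.Hom (regular D) Y where
  toFun m := m • y
  map_smul m n := mul_smul m n y
  map_cond b m n := Y.cond_smul b m n y
  map_glue _ hQ hi f := BJStructure.eq_glue fun b =>
    Y.rel_smul_left (D.bj.rel_glue hQ hi f b) y

end BMSet

/-! ### Matched pairs whose classifying localic category is a groupoid -/

namespace MatchedPair

variable {B M : Type u} [BooleanAlgebra B] [Monoid M] (D : MatchedPair B M)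

section

variable {D} {b c : B} {m n : M}

theorem Rel.mul_right (h : D.bj.Rel b m n) (p : M) : D.bj.Rel b (m * p) (n * p) :=
  (BMSet.regular D).rel_smul_left h p

theorem Rel.mul_left (h : D.bj.Rel b m n) (p : M) : D.bj.Rel (D.star p b) (p * m) (p * n) :=
  (BMSet.regular D).rel_smul_right p h

theorem Rel.inf_star (h : D.bj.Rel b m n) (e : B) : b ⊓ D.star m e = b ⊓ D.star n e := by
  have := D.cond_star b m n e
  rw [show D.bj.cond b m n = n from h] at this
  rw [this, inf_sup_left]
  simp [← inf_assoc]

end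

/-- Restriction of closed ideals along `m ^*`, right adjoint to `D.pull m`. -/
def comap (m : M) (K : Idl D.J) : Idl D.J where
  carrier := {b | D.star m b ∈ K}
  bot_mem := by
    change D.star m ⊥ ∈ K
    rw [map_bot]
    exact K.bot_mem
  sup_mem b hb c hc := by
    change D.star m (b ⊔ c) ∈ K
    rw [map_sup]
    exact K.sup_mem _ hb _ hc
  lower b hb c hc := K.lower _ hb _ (OrderHomClass.mono (D.star m) hc)
  closed b P := by
    rintro ⟨⟨Q, hQ, hPQ⟩, hlub⟩ hP
    refine K.closed _ {d | d ≠ ⊥ ∧ ∃ p ∈ P, D.star m p = d} ⟨⟨_, D.star_mem m Q hQ, ?_⟩, ?_, ?_⟩ ?_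
    · rintro d ⟨hd, p, hp, rfl⟩
      exact ⟨hd, p, hPQ hp, rfl⟩
    · rintro d ⟨_, p, hp, rfl⟩
      exact OrderHomClass.mono (D.star m) (hlub.1 hp)
    · intro t ht
      -- `m ^* b ⊓ tᶜ` is disjoint from every member of the partition `m ^* Q` of `⊤`.
      have h1 : (⊤ : B) ≤ (D.star m b ⊓ tᶜ)ᶜ := by
        refine (D.J.isPartition _ (D.star_mem m Q hQ)).isLUB.2 ?_
        rintro d ⟨hd, q, hq, rfl⟩
        rw [le_compl_iff_disjoint_right]
        by_cases hqP : q ∈ P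
        · exact disjoint_compl_right.mono (ht ⟨hd, q, hqP, rfl⟩) inf_le_right
        · have h2 : b ≤ qᶜ := hlub.2 fun p hp => by
            rw [le_compl_iff_disjoint_right, disjoint_iff]
            exact (D.J.isPartition Q hQ).disjoint p (hPQ hp) q hq (by rintro rfl; exact hqP hp)
          refine Disjoint.mono_right inf_le_left ?_
          rw [disjoint_iff, ← map_inf, inf_comm, (le_compl_iff_disjoint_right.1 h2).eq_bot, map_bot]
      have h3 : D.star m b ⊓ tᶜ = ⊥ := by
        rw [← compl_eq_top]
        exact top_le_iff.1 h1
      exact disjoint_compl_right_iff.1 (disjoint_iff.2 h3)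
    · rintro d ⟨_, p, hp, rfl⟩
      exact hP hp

theorem pull_le {m : M} {I K : Idl D.J} : D.pull m I ≤ K ↔ I ≤ D.comap m K :=
  ⟨fun h _ hb => h (D.star_mem_pull m I hb), fun h _ hb => hb K fun _ he => h he⟩

theorem pull_gc (m : M) : GaloisConnection (D.pull m) (D.comap m) := fun _ _ => D.pull_le

theorem pull_one (I : Idl D.J) : D.pull 1 I = I := by
  refine le_antisymm (D.pull_le.2 fun b hb => ?_) fun b hb => ?_
  · change D.star 1 b ∈ I
    rwa [D.star_one]
  · rw [← D.star_one b]
    exact D.star_mem_pull 1 I hb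

theorem pull_mul (m n : M) (I : Idl D.J) : D.pull (m * n) I = D.pull m (D.pull n I) := by
  have key : D.pull n I ≤ D.comap m (D.pull (m * n) I) := D.pull_le.2 fun b hb => by
    change D.star m (D.star n b) ∈ D.pull (m * n) I
    rw [← D.star_mul]
    exact D.star_mem_pull _ I hb
  refine le_antisymm (D.pull_le.2 fun b hb => ?_) (D.pull_le.2 key)
  change D.star (m * n) b ∈ D.pull m (D.pull n I)
  rw [D.star_mul]
  exact D.star_mem_pull m _ (D.star_mem_pull n I hb)

theorem pull_top (m : M) : D.pull m ⊤ = ⊤ := by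
  refine eq_top_iff.2 fun b _ => Idl.eq_top_of_mem ?_ b
  rw [← map_top (D.star m)]
  exact D.star_mem_pull m ⊤ Idl.mem_top

/-- Inverse image along the target map preserves binary intersections since each `m ^*` does. -/
theorem pull_inf (m : M) (I K : Idl D.J) : D.pull m (I ⊓ K) = D.pull m I ⊓ D.pull m K := by
  refine le_antisymm (le_inf ((D.pull_gc m).monotone_l inf_le_left)
    ((D.pull_gc m).monotone_l inf_le_right)) fun x hx => ?_
  obtain ⟨hI, hK⟩ := Idl.mem_inf.1 hx
  have h1 : ∀ b ∈ I, x ∈ Idl.residual (D.star m b) (D.pull m (I ⊓ K)) := fun b hb =>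
    hK _ fun e he => by
      rw [Idl.mem_residual, ← map_inf]
      exact D.star_mem_pull m _ (Idl.mem_inf.2 ⟨I.lower _ hb _ inf_le_left,
        K.lower _ he _ inf_le_right⟩)
  have h2 : x ∈ Idl.residual x (D.pull m (I ⊓ K)) := hI _ fun b hb => by
    have h3 := h1 b hb
    rw [Idl.mem_residual] at h3 ⊢
    rwa [inf_comm x]
  simpa [Idl.mem_residual] using h2

theorem pull_sSup (m : M) (T : Set (Idl D.J)) : D.pull m (sSup T) = sSup (D.pull m '' T) := by
  rw [(D.pull_gc m).l_sSup, sSup_image]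

/-! #### Lattice operations on the frames of arrows and of composable pairs -/

theorem C₁.toFun_inf (f g : D.C₁) (m : M) : (f ⊓ g).toFun m = f.toFun m ⊓ g.toFun m := by
  refine le_antisymm (le_inf ((inf_le_left : f ⊓ g ≤ f) m) ((inf_le_right : f ⊓ g ≤ g) m)) ?_
  let k : D.C₁ := ⟨fun m => f.toFun m ⊓ g.toFun m, fun b m n h =>
    (f.rel b m n h).inf (g.rel b m n h)⟩
  have hk : k ≤ f ⊓ g := le_inf (fun m => (inf_le_left : f.toFun m ⊓ g.toFun m ≤ _))
    (fun m => (inf_le_right : f.toFun m ⊓ g.toFun m ≤ _))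
  exact hk m

theorem C₁.toFun_top (m : M) : (⊤ : D.C₁).toFun m = ⊤ := by
  refine eq_top_iff.2 ?_
  have : D.src ⊤ ≤ ⊤ := le_top
  exact this m

theorem C₁.toFun_sSup (T : Set D.C₁) (m : M) :
    (sSup T).toFun m = sSup ((fun f : D.C₁ => f.toFun m) '' T) := by
  refine le_antisymm ?_ (sSup_le ?_)
  · let k : D.C₁ := ⟨fun m => sSup ((fun f : D.C₁ => f.toFun m) '' T), fun b m n h =>
      Idl.Rel.sSup_image fun f _ => f.rel b m n h⟩
    have hk : sSup T ≤ k := sSup_le fun f hf m =>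
      (le_sSup ⟨f, hf, rfl⟩ : f.toFun m ≤ sSup ((fun f : D.C₁ => f.toFun m) '' T))
    exact hk m
  · rintro _ ⟨f, hf, rfl⟩
    exact (le_sSup hf : f ≤ sSup T) m

theorem C₂.toFun_inf (f g : D.C₂) (m n : M) :
    (f ⊓ g).toFun m n = f.toFun m n ⊓ g.toFun m n := by
  refine le_antisymm (le_inf ((inf_le_left : f ⊓ g ≤ f) m n) ((inf_le_right : f ⊓ g ≤ g) m n)) ?_
  let k : D.C₂ := ⟨fun m n => f.toFun m n ⊓ g.toFun m n, fun n b m m' h =>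
    (f.rel_left n b m m' h).inf (g.rel_left n b m m' h), fun m b n n' h =>
    (f.rel_right m b n n' h).inf (g.rel_right m b n n' h)⟩
  have hk : k ≤ f ⊓ g := le_inf (fun m n => (inf_le_left : f.toFun m n ⊓ g.toFun m n ≤ _))
    (fun m n => (inf_le_right : f.toFun m n ⊓ g.toFun m n ≤ _))
  exact hk m n

theorem C₂.toFun_top (m n : M) : (⊤ : D.C₂).toFun m n = ⊤ := by
  refine eq_top_iff.2 ?_
  have : D.fst (D.src ⊤) ≤ ⊤ := le_top
  exact this m n

theorem C₂.toFun_sSup (T : Set D.C₂) (m n : M) :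
    (sSup T).toFun m n = sSup ((fun f : D.C₂ => f.toFun m n) '' T) := by
  refine le_antisymm ?_ (sSup_le ?_)
  · let k : D.C₂ := ⟨fun m n => sSup ((fun f : D.C₂ => f.toFun m n) '' T), fun n b m m' h =>
      Idl.Rel.sSup_image fun f _ => f.rel_left n b m m' h, fun m b n n' h =>
      Idl.Rel.sSup_image fun f _ => f.rel_right m b n n' h⟩
    have hk : sSup T ≤ k := sSup_le fun f hf m n =>
      (le_sSup ⟨f, hf, rfl⟩ : f.toFun m n ≤ sSup ((fun f : D.C₂ => f.toFun m n) '' T))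
    exact hk m n
  · rintro _ ⟨f, hf, rfl⟩
    exact (le_sSup hf : f ≤ sSup T) m n

/-! #### Groupoids have local right inverses -/

/-- The region on which `m` and `n` agree. -/
def agree (m n : M) : Idl D.J where
  carrier := {b | D.bj.Rel b m n}
  bot_mem := D.bj.rel_bot m n
  sup_mem _ hb _ hc := hb.sup hc
  lower _ hb _ hc := hb.mono hc
  closed b P := by
    rintro ⟨⟨Q, hQ, hPQ⟩, hlub⟩ hP
    -- The members of `Q` outside `P` are disjoint from `b`, so `cond b m n` is `n` on them.
    refine BJStructure.eq_of_rel_parts (S := D.bj) hQ fun q hq => ?_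
    by_cases hqP : q ∈ P
    · have hqb : q ≤ b := hlub.1 hqP
      exact ((D.bj.rel_cond b m n).mono hqb).trans (hP hqP)
    · refine (D.bj.rel_compl_cond b m n).mono ?_
      rw [le_compl_comm]
      refine hlub.2 fun p hp => ?_
      rw [le_compl_iff_disjoint_right, disjoint_iff]
      exact (D.J.isPartition Q hQ).disjoint p (hPQ hp) q hq (by rintro rfl; exact hqP hp)

/-- The open set of identity arrows, the image of the section `1` of the source map. -/
def identities : D.C₁ where
  toFun m := D.agree m 1
  rel _ _ _ h _ hc := ⟨fun h' => (h.mono hc).symm.trans h', fun h' => (h.mono hc).trans h'⟩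

/-- The open set of arrows which locally have a right inverse. -/
def rightInvertible : D.C₁ where
  toFun m := Idl.gen D.J {b | ∃ n, D.bj.Rel b (m * n) 1}
  rel b m n h := by
    have aux : ∀ m n : M, D.bj.Rel b m n → ∀ c ≤ b,
        c ∈ Idl.gen D.J {b | ∃ k, D.bj.Rel b (m * k) 1} →
        c ∈ Idl.gen D.J {b | ∃ k, D.bj.Rel b (n * k) 1} := by
      intro m n h c hc hm
      have h1 : c ∈ Idl.residual b (Idl.gen D.J {b | ∃ k, D.bj.Rel b (n * k) 1}) := by
        refine hm _ ?_
        rintro e ⟨k, hk⟩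
        exact Idl.subset_gen ⟨k, ((Rel.mul_right h.symm k).mono inf_le_left).trans
          (hk.mono inf_le_right)⟩
      rwa [Idl.mem_residual, inf_eq_right.2 hc] at h1
    exact fun c hc => ⟨aux m n h c hc, aux n m h.symm c hc⟩

/-- A composable pair with composite an identity has a right invertible first arrow. Applied to the
pairs `⟨1, inv⟩`, this shows that in a groupoid all arrows are right invertible. -/
theorem IsLocalicGroupoid.exists_right_inverse {D : MatchedPair B M} (h : D.IsLocalicGroupoid)
    (m : M) : (⊤ : B) ∈ Idl.gen D.J {b | ∃ n, D.bj.Rel b (m * n) 1} := by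
  obtain ⟨-, l, -, -, -, hfst, -, hcomp, -⟩ := h
  have h1 : D.compos D.identities ≤ D.fst D.rightInvertible := fun m n b hb =>
    Idl.subset_gen ⟨n, hb⟩
  have h2 := OrderHomClass.mono l h1
  rw [hfst, hcomp] at h2
  exact h2 m (D.bj.rel_refl ⊤ 1)

/-! #### Local inverses make the classifying localic category a groupoid -/

/-- `n` restricted to `c` is inverse to `m` restricted to `b`. The region `c` need not be the exact
image of `b` under `m`, but contains it. -/
structure IsLocalInverse (m : M) (b : B) (n : M) (c : B) : Prop where
  mul_rel : D.bj.Rel b (m * n) 1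
  rel_mul : D.bj.Rel c (n * m) 1
  le_star : b ≤ D.star m c

/-- Every `m` is invertible locally on the objects. -/
def LocallyInvertible : Prop :=
  ∀ m, (⊤ : B) ∈ Idl.gen D.J {b | ∃ n c, D.IsLocalInverse m b n c}

section

variable {D} {b b' c c' : B} {m m' n n' : M}

theorem IsLocalInverse.le_star_star (h : D.IsLocalInverse m b n c) :
    b ⊓ b' ≤ D.star m (D.star n b') := by
  have h1 := Rel.inf_star h.mul_rel b'
  rw [D.star_one, D.star_mul] at h1
  exact h1 ▸ inf_le_right

/-- Local inverses are unique. -/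
theorem IsLocalInverse.unique (h : D.IsLocalInverse m b n c) (h' : D.IsLocalInverse m b' n' c') :
    ∃ d, b ⊓ b' ≤ D.star m d ∧ D.bj.Rel d n n' := by
  refine ⟨c ⊓ D.star n b', ?_, ?_⟩
  · rw [map_inf]
    exact le_inf (inf_le_left.trans h.le_star) h.le_star_star
  · have h1 := Rel.mul_right h.rel_mul n'
    have h2 := Rel.mul_left h'.mul_rel n
    rw [one_mul, mul_assoc] at h1
    rw [mul_one] at h2
    exact (h2.symm.mono inf_le_right).trans (h1.mono inf_le_left)

/-- Local inverses of `m` are local inverses of any `m'` wherever `m'` agrees with `m`. -/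
theorem IsLocalInverse.congr (h : D.IsLocalInverse m b n c) (hm : D.bj.Rel b' m m') :
    D.IsLocalInverse m' (b' ⊓ b) n (c ⊓ D.star n b') where
  mul_rel := ((Rel.mul_right hm.symm n).mono inf_le_left).trans (h.mul_rel.mono inf_le_right)
  rel_mul := ((Rel.mul_left hm.symm n).mono inf_le_right).trans (h.rel_mul.mono inf_le_left)
  le_star := by
    have h1 : b' ⊓ b ≤ D.star m (c ⊓ D.star n b') := by
      rw [map_inf, inf_comm]
      exact le_inf (inf_le_left.trans h.le_star) h.le_star_star
    have h2 := Rel.inf_star hm (c ⊓ D.star n b')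
    exact (le_inf inf_le_left h1).trans (h2.le.trans inf_le_right)

end

/-- Data for a frame homomorphism into the frame of arrows of a locally invertible matched pair:
`toFun x m n` is the value at `m`, over any region where `n` is inverse to `m`. The first two axioms
say that these values agree where they overlap, and that they depend on `m` only locally. -/
structure InverseRule (L : Type u) [CompleteLattice L] where
  toFun : L → M → M → Idl D.J
  congr_right : ∀ x m d n n', D.bj.Rel d n n' → Idl.Rel (D.star m d) (toFun x m n) (toFun x m n')
  congr_left : ∀ x n b m m', D.bj.Rel b m m' →
    Idl.Rel (b ⊓ D.star m' (D.star n b)) (toFun x m n) (toFun x m' n)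
  map_top : ∀ m n, toFun ⊤ m n = ⊤
  map_inf : ∀ x y m n, toFun (x ⊓ y) m n = toFun x m n ⊓ toFun y m n
  map_sSup : ∀ T m n, toFun (sSup T) m n = sSup ((fun x => toFun x m n) '' T)

namespace InverseRule

variable {D} {L : Type u} [CompleteLattice L] (Φ : D.InverseRule L)

/-- The value at `m` obtained by patching the values over the local inverses of `m`. -/
def patch (x : L) (m : M) : Idl D.J :=
  Idl.gen D.J {e | ∃ b n c, D.IsLocalInverse m b n c ∧ e ≤ b ∧ e ∈ Φ.toFun x m n}

theorem patch_rel (x : L) {m n : M} {b c : B} (h : D.IsLocalInverse m b n c) :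
    Idl.Rel b (Φ.patch x m) (Φ.toFun x m n) := by
  refine fun e he => ⟨fun hm => ?_, fun hm => Idl.subset_gen ⟨b, n, c, h, he, hm⟩⟩
  have h1 : e ∈ Idl.residual b (Φ.toFun x m n) := by
    refine hm _ ?_
    rintro d ⟨b', n', c', h', hd, hmem⟩
    obtain ⟨k, hk, hrel⟩ := h.unique h'
    exact (Φ.congr_right x m k n n' hrel _ ((inf_le_inf_left b hd).trans hk)).2
      (Idl.lower _ _ hmem _ inf_le_right)
  rwa [Idl.mem_residual, inf_eq_right.2 he] at h1

variable (hD : D.LocallyInvertible)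

/-- The value of the frame homomorphism attached to a rule. -/
def arrow (x : L) : D.C₁ where
  toFun := Φ.patch x
  rel b m m' h := by
    refine .of_cover (hD m) ?_
    rintro b' ⟨n, c, hn⟩
    have hn' := hn.congr h
    refine ((Φ.patch_rel x hn).mono inf_le_right).trans (.trans ?_ (Φ.patch_rel x hn').symm)
    refine (Φ.congr_left x n b m m' h).mono (le_inf inf_le_left (hn'.le_star.trans ?_))
    exact OrderHomClass.mono (D.star m') inf_le_right

end InverseRule

variable {D} in
theorem LocallyInvertible.ext (hD : D.LocallyInvertible) {f g : D.C₁}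
    (h : ∀ m b n c, D.IsLocalInverse m b n c → Idl.Rel b (f.toFun m) (g.toFun m)) : f = g := by
  refine C₁.ext (funext fun m => Idl.eq_of_cover (hD m) ?_)
  rintro b ⟨n, c, hn⟩
  exact h m b n c hn

/-- The frame homomorphism attached to a rule. -/
def InverseRule.frameHom {D : MatchedPair B M} {L : Type u} [CompleteLattice L]
    (Φ : D.InverseRule L) (hD : D.LocallyInvertible) : FrameHom L D.C₁ where
  toFun := Φ.arrow hD
  map_inf' x y := hD.ext fun m b n c h => by
    rw [C₁.toFun_inf]
    refine (Φ.patch_rel _ h).trans ?_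
    rw [Φ.map_inf]
    exact ((Φ.patch_rel x h).inf (Φ.patch_rel y h)).symm
  map_top' := hD.ext fun m b n c h => by
    rw [C₁.toFun_top]
    refine (Φ.patch_rel _ h).trans ?_
    rw [Φ.map_top]
    exact .refl _ _
  map_sSup' T := hD.ext fun m b n c h => by
    change Idl.Rel b _ ((sSup (Φ.arrow hD '' T)).toFun m)
    rw [C₁.toFun_sSup, Set.image_image]
    refine (Φ.patch_rel _ h).trans ?_
    rw [Φ.map_sSup]
    exact (Idl.Rel.sSup_image fun x _ => Φ.patch_rel x h).symm

theorem InverseRule.frameHom_rel {D : MatchedPair B M} {L : Type u} [CompleteLattice L]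
    (Φ : D.InverseRule L) (hD : D.LocallyInvertible) (x : L) {m n : M} {b c : B}
    (h : D.IsLocalInverse m b n c) :
    Idl.Rel b ((Φ.frameHom hD x).toFun m) (Φ.toFun x m n) :=
  Φ.patch_rel x h

/-- The inversion map: the value at `m` is that of `f` at the local inverse of `m`, transported from
the target of `m` to its source. -/
def invRule : D.InverseRule D.C₁ where
  toFun f m n := D.pull m (f.toFun n)
  congr_right f m d n n' h := D.pull_rel_right m (f.rel d n n' h)
  congr_left f n b m m' h := (D.pull_rel_left h (f.toFun n)).mono inf_le_left
  map_top m n := by rw [C₁.toFun_top, pull_top]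
  map_inf f g m n := by rw [C₁.toFun_inf, pull_inf]
  map_sSup T m n := by rw [C₁.toFun_sSup, pull_sSup, Set.image_image]

/-- The map `⟨1, inv⟩` from arrows to composable pairs. -/
def leftRule : D.InverseRule D.C₂ where
  toFun h m n := h.toFun m n
  congr_right h m d n n' hn := h.rel_right m d n n' hn
  congr_left h n b m m' hm := (h.rel_left n b m m' hm).mono inf_le_left
  map_top m n := C₂.toFun_top D m n
  map_inf f g m n := C₂.toFun_inf D f g m n
  map_sSup T m n := C₂.toFun_sSup D T m n

/-- The map `⟨inv, 1⟩` from arrows to composable pairs. Values on a pair are taken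
over the source of the first arrow, here the target of `m`, whence the transport along `m`. -/
def rightRule : D.InverseRule D.C₂ where
  toFun h m n := D.pull m (h.toFun n m)
  congr_right h m d n n' hn := D.pull_rel_right m (h.rel_left m d n n' hn)
  congr_left h n b m m' hm := ((D.pull_rel_left hm _).mono inf_le_left).trans
    ((D.pull_rel_right m' (h.rel_right n b m m' hm)).mono inf_le_right)
  map_top m n := by rw [C₂.toFun_top, pull_top]
  map_inf f g m n := by rw [C₂.toFun_inf, pull_inf]
  map_sSup T m n := by rw [C₂.toFun_sSup, pull_sSup, Set.image_image]

variable {D} in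
theorem IsLocalInverse.pull_pull {m n : M} {b c : B} (h : D.IsLocalInverse m b n c)
    (I : Idl D.J) : Idl.Rel b (D.pull m (D.pull n I)) I := by
  have := D.pull_rel_left h.mul_rel I
  rwa [pull_mul, pull_one] at this

variable {D} in
theorem LocallyInvertible.isLocalicGroupoid (hD : D.LocallyInvertible) : D.IsLocalicGroupoid := by
  refine ⟨D.invRule.frameHom hD, D.leftRule.frameHom hD, D.rightRule.frameHom hD,
    fun I => hD.ext fun m b n c h => ?_, fun I => hD.ext fun m b n c h => ?_,
    fun f => hD.ext fun m b n c h => ?_, fun f => hD.ext fun m b n c h => ?_,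
    fun f => hD.ext fun m b n c h => ?_, fun f => hD.ext fun m b n c h => ?_,
    fun f => hD.ext fun m b n c h => ?_, fun f => hD.ext fun m b n c h => ?_⟩
  · exact D.invRule.frameHom_rel hD _ h
  · exact (D.invRule.frameHom_rel hD _ h).trans (h.pull_pull I)
  · exact D.leftRule.frameHom_rel hD _ h
  · exact (D.leftRule.frameHom_rel hD _ h).trans (D.invRule.frameHom_rel hD _ h).symm
  · exact (D.leftRule.frameHom_rel hD _ h).trans (f.rel b _ _ h.mul_rel)
  · exact (D.rightRule.frameHom_rel hD _ h).trans (D.invRule.frameHom_rel hD _ h).symm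
  · exact (D.rightRule.frameHom_rel hD _ h).trans (h.pull_pull (f.toFun m))
  · exact (D.rightRule.frameHom_rel hD _ h).trans
      ((D.pull_rel_right m (f.rel c _ _ h.rel_mul)).mono h.le_star)

end MatchedPair

/-! ### Words and left ideals -/

section Words

variable {A : Type u}

/-- Membership in the closure of a left ideal `I`, generated from `I` by the rule defining closed
ideals. Induction on this predicate is well-founded induction on trees branching over `A`. -/
inductive Covers (I : Set (List A)) : List A → Prop
  | mem {w : List A} : w ∈ I → Covers I w
  | step {w : List A} : (∀ a, Covers I (a :: w)) → Covers I w

namespace Covers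

variable {I K : Set (List A)} {w : List A}

/-- Density is transitive: a cover of `w` can be refined by covers of its members. -/
theorem bind (h : Covers I w) (hK : ∀ u, u ++ w ∈ I → Covers K (u ++ w)) : Covers K w := by
  induction h with
  | mem hw => exact hK [] hw
  | @step w _ ih =>
    exact .step fun a => ih a fun u hu => by simpa using hK (u ++ [a]) (by simpa using hu)

theorem mono (h : Covers I w) (hIK : I ⊆ K) : Covers K w := h.bind fun _ hu => .mem (hIK hu)

theorem append (h : Covers I w) (hI : IsLeftIdeal I) (v : List A) : Covers I (v ++ w) := by
  induction h generalizing v with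
  | mem hw => exact .mem (hI v _ hw)
  | @step w h ih =>
    obtain rfl | ⟨v, a, rfl⟩ := v.eq_nil_or_concat
    · exact .step h
    · simpa using ih a v

theorem inter (h : Covers I w) (h' : Covers K w) (hI : IsLeftIdeal I) (hK : IsLeftIdeal K) :
    Covers (I ∩ K) w :=
  h.bind fun u hu => (h'.append hK u).bind fun v hv => .mem ⟨hI v _ hu, hv⟩

theorem mem_of_isClosedIdeal (h : Covers K w) (hK : IsClosedIdeal K) : w ∈ K := by
  induction h with
  | mem hw => exact hw
  | step _ ih => exact hK.2 _ ih

theorem false_of_empty [Nonempty A] (h : Covers (∅ : Set (List A)) w) : False := by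
  induction h with
  | mem hw => exact hw
  | step _ ih => exact ih (Classical.arbitrary A)

theorem of_append {u : List A} (h : Covers I (u ++ w)) : Covers {u | u ++ w ∈ I} u := by
  generalize hv : u ++ w = v at h
  induction h generalizing u with
  | mem hw => exact .mem (by simpa [hv] using hw)
  | step _ ih => exact .step fun a => ih a (by simp [hv])

theorem append_right {u : List A} (h : Covers {u | u ++ w ∈ I} u) : Covers I (u ++ w) := by
  induction h with
  | mem hw => exact .mem hw
  | step _ ih => exact .step fun a => ih a

end Covers

theorem IsLeftIdeal.isClosedIdeal_covers {I : Set (List A)} (hI : IsLeftIdeal I) :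
    IsClosedIdeal {w | Covers I w} :=
  ⟨fun v _ h => Covers.append h hI v, fun _ h => Covers.step h⟩

theorem isDenseIdeal_iff {I : Set (List A)} :
    IsDenseIdeal I ↔ IsLeftIdeal I ∧ ∀ w, Covers I w := by
  refine ⟨fun h => ⟨h.1, fun w => ?_⟩, fun h => ⟨h.1, fun K hK hIK => ?_⟩⟩
  · have := h.2 _ h.1.isClosedIdeal_covers fun _ hw => .mem hw
    exact Set.eq_univ_iff_forall.1 this w
  · exact Set.eq_univ_of_forall fun w => ((h.2 w).mono hIK).mem_of_isClosedIdeal hK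

namespace SelfSimilarAction

variable {P : Type u} [Monoid P] (δ : SelfSimilarAction P A)

theorem resWord_append (p : P) (u w : List A) :
    δ.resWord p (u ++ w) = δ.resWord (δ.resWord p w) u := by
  induction u with
  | nil => rfl
  | cons a u ih => exact congrArg (δ.res · a) ih

theorem actWord_append (p : P) (u w : List A) :
    δ.actWord p (u ++ w) = δ.actWord (δ.resWord p w) u ++ δ.actWord p w := by
  induction u with
  | nil => rfl
  | cons a u ih =>
    change δ.act a (δ.resWord p (u ++ w)) :: δ.actWord p (u ++ w) = _
    rw [ih, resWord_append]
    rfl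

theorem resWord_one (w : List A) : δ.resWord 1 w = 1 := by
  induction w with
  | nil => rfl
  | cons a w ih => exact (congrArg (δ.res · a) ih).trans (δ.res_one a)

theorem actWord_one (w : List A) : δ.actWord 1 w = w := by
  induction w with
  | nil => rfl
  | cons a w ih =>
    change δ.act a (δ.resWord 1 w) :: δ.actWord 1 w = _
    rw [ih, resWord_one, act_one]

theorem resWord_mul (p q : P) (w : List A) :
    δ.resWord (p * q) w = δ.resWord p w * δ.resWord q (δ.actWord p w) := by
  induction w with
  | nil => rfl
  | cons a w ih => exact (congrArg (δ.res · a) ih).trans (δ.res_mul _ _ a)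

theorem actWord_mul (p q : P) (w : List A) :
    δ.actWord (p * q) w = δ.actWord q (δ.actWord p w) := by
  induction w with
  | nil => rfl
  | cons a w ih =>
    change δ.act a (δ.resWord (p * q) w) :: δ.actWord (p * q) w = _
    rw [ih, resWord_mul, act_mul]
    rfl

theorem isLeftIdeal_preimage {I : Set (List A)} (hI : IsLeftIdeal I) (p : P) :
    IsLeftIdeal {w | δ.actWord p w ∈ I} := fun v w hw => by
  change δ.actWord p (v ++ w) ∈ I
  rw [actWord_append]
  exact hI _ _ hw

theorem isUnit_resWord {p : P} (hp : IsUnit p) (w : List A) : IsUnit (δ.resWord p w) := by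
  induction w with
  | nil => exact hp
  | cons a w ih =>
    obtain ⟨g, hg⟩ := ih
    have h : δ.resWord p (a :: w) = (δ.units.res g a : Pˣ) := congrArg (δ.res · a) hg.symm
    exact h ▸ Units.isUnit _

end SelfSimilarAction

theorem Covers.actWord {P : Type u} [Monoid P] {δ : SelfSimilarAction P A} {I : Set (List A)}
    {p : P} {w : List A} (h : Covers I (δ.actWord p w)) : Covers {w | δ.actWord p w ∈ I} w := by
  generalize hv : δ.actWord p w = v at h
  induction h generalizing w with
  | mem hw => exact .mem (by simpa [hv] using hw)
  | step _ ih => exact .step fun a => ih (δ.act a (δ.resWord p w)) (congrArg (_ :: ·) hv)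

end Words

/-! ### The Grothendieck Boolean algebra of decidable closed ideals -/

section Clopens

variable {A : Type u}

/-- The pseudocomplement of a left ideal. -/
def exterior (I : Set (List A)) : Set (List A) := {w | ∀ u, u ++ w ∉ I}

theorem isLeftIdeal_exterior (I : Set (List A)) : IsLeftIdeal (exterior I) := fun v w hw u hu =>
  hw (u ++ v) (by simpa using hu)

theorem IsLeftIdeal.union {I K : Set (List A)} (hI : IsLeftIdeal I) (hK : IsLeftIdeal K) :
    IsLeftIdeal (I ∪ K) := fun v w hw => hw.imp (hI v w) (hK v w)

theorem IsLeftIdeal.inter {I K : Set (List A)} (hI : IsLeftIdeal I) (hK : IsLeftIdeal K) :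
    IsLeftIdeal (I ∩ K) := fun v w hw => ⟨hI v w hw.1, hK v w hw.2⟩

variable (A) in
/-- A complemented closed left ideal of the free monoid; equivalently, a clopen set of infinite
words when `A` is finite. -/
@[ext]
structure Clopen : Type u where
  carrier : Set (List A)
  isClosedIdeal : IsClosedIdeal carrier
  decided : ∀ w, Covers (carrier ∪ exterior carrier) w

namespace Clopen

instance : SetLike (Clopen A) (List A) where
  coe := carrier
  coe_injective _ _ := Clopen.ext

instance : PartialOrder (Clopen A) := .ofSetLike (Clopen A) (List A)

variable {b c : Clopen A} {w : List A}

theorem append_mem (h : w ∈ b) (u : List A) : u ++ w ∈ b := b.isClosedIdeal.1 u w h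

theorem mem_of_covers (h : Covers b w) : w ∈ b := h.mem_of_isClosedIdeal b.isClosedIdeal

theorem append_mem_exterior (h : w ∈ exterior (b : Set (List A))) (u : List A) :
    u ++ w ∈ exterior (b : Set (List A)) := isLeftIdeal_exterior _ u w h

theorem isLeftIdeal_decided (b : Clopen A) : IsLeftIdeal (b ∪ exterior b : Set (List A)) :=
  b.isClosedIdeal.1.union (isLeftIdeal_exterior _)

theorem covers_decided_inter (b c : Clopen A) (w : List A) :
    Covers ((b ∪ exterior b) ∩ (c ∪ exterior c) : Set (List A)) w :=
  (b.decided w).inter (c.decided w) b.isLeftIdeal_decided c.isLeftIdeal_decided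

theorem isClosedIdeal_exterior [Nonempty A] (b : Clopen A) :
    IsClosedIdeal (exterior (b : Set (List A))) := by
  refine ⟨isLeftIdeal_exterior _, fun w hw u hu => ?_⟩
  obtain rfl | ⟨u, a, rfl⟩ := u.eq_nil_or_concat
  · exact hw (Classical.arbitrary A) [] (append_mem hu [_])
  · exact hw a u (by simpa using hu)

instance : Min (Clopen A) where
  min b c :=
    { carrier := b ∩ c
      isClosedIdeal := ⟨b.isClosedIdeal.1.inter c.isClosedIdeal.1, fun w hw =>
        ⟨b.isClosedIdeal.2 w fun a => (hw a).1, c.isClosedIdeal.2 w fun a => (hw a).2⟩⟩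
      decided := fun w => (covers_decided_inter b c w).mono <| by
        rintro w ⟨hb | hb, hc | hc⟩
        · exact .inl ⟨hb, hc⟩
        · exact .inr fun u hu => hc u hu.2
        · exact .inr fun u hu => hb u hu.1
        · exact .inr fun u hu => hb u hu.1 }

instance [Nonempty A] : Compl (Clopen A) where
  compl b :=
    { carrier := exterior b
      isClosedIdeal := b.isClosedIdeal_exterior
      decided := fun w => (b.decided w).mono <| by
        rintro w (hb | hb)
        · exact .inr fun u hu => hu [] (append_mem (b := b) hb u)
        · exact .inl hb }

theorem mem_inf : w ∈ b ⊓ c ↔ w ∈ b ∧ w ∈ c := Iff.rfl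

section

variable [Nonempty A]

theorem mem_compl : w ∈ bᶜ ↔ w ∈ exterior (b : Set (List A)) := Iff.rfl

instance : Lattice (Clopen A) where
  sup b c := (bᶜ ⊓ cᶜ)ᶜ
  le_sup_left _ _ _ hw u hu := hu.1 [] (append_mem hw u)
  le_sup_right _ _ _ hw u hu := hu.2 [] (append_mem hw u)
  sup_le b c d hb hc w hw := by
    refine mem_of_covers ((covers_decided_inter b c w).bind fun u hu => .mem ?_)
    obtain ⟨h1 | h1, h2⟩ := hu
    · exact hb h1
    · obtain h2 | h2 := h2
      · exact hc h2
      · exact absurd ⟨h1, h2⟩ (hw u)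
  inf := (· ⊓ ·)
  inf_le_left _ _ _ hw := hw.1
  inf_le_right _ _ _ hw := hw.2
  le_inf _ _ _ hb hc _ hw := ⟨hb hw, hc hw⟩

theorem mem_sup : w ∈ b ⊔ c ↔ ∀ u, ¬(u ++ w ∈ bᶜ ∧ u ++ w ∈ cᶜ) := Iff.rfl

instance : BooleanAlgebra (Clopen A) where
  le_sup_inf x y z w hw u hu := by
    refine Covers.false_of_empty (w := u ++ w) ?_
    refine (covers_decided_inter y z (u ++ w)).bind fun v hv => (?_ : False).elim
    have hx : v ++ (u ++ w) ∈ xᶜ := append_mem_exterior (b := x) hu.1 v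
    have h1 := mem_sup.1 hw.1 (v ++ u)
    have h2 := mem_sup.1 hw.2 (v ++ u)
    rw [List.append_assoc] at h1 h2
    obtain ⟨hy | hy, hz | hz⟩ := hv
    · exact hu.2 v ⟨hy, hz⟩
    · exact h2 ⟨hx, hz⟩
    · exact h1 ⟨hx, hy⟩
    · exact h1 ⟨hx, hy⟩
  top := ⟨Set.univ, ⟨fun _ _ _ => trivial, fun _ _ => trivial⟩, fun _ => .mem (.inl trivial)⟩
  bot := ⟨∅, ⟨fun _ _ h => h, fun _ h => h (Classical.arbitrary A)⟩,
    fun _ => .mem (.inr fun _ h => h)⟩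
  inf_compl_le_bot _ _ hw := hw.2 [] hw.1
  top_le_sup_compl _ _ _ u hu := hu.2 [] hu.1
  le_top _ _ _ := trivial
  bot_le _ _ hw := hw.elim

theorem mem_top : w ∈ (⊤ : Clopen A) := trivial

theorem not_mem_bot : w ∉ (⊥ : Clopen A) := id

theorem bot_ne_top : (⊥ : Clopen A) ≠ ⊤ := fun h =>
  not_mem_bot (A := A) (w := []) (h ▸ mem_top)

theorem covers_compl (b : Clopen A) (w : List A) : Covers {w | w ∈ b ∨ w ∈ bᶜ} w := b.decided w

theorem eq_bot_iff_forall : b = ⊥ ↔ ∀ w, w ∉ b :=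
  ⟨fun h _ => h ▸ not_mem_bot, fun h => SetLike.ext fun w => iff_of_false (h w) not_mem_bot⟩

theorem not_mem_of_inf_eq_bot (h : b ⊓ c = ⊥) (hb : w ∈ b) : w ∉ c := fun hc =>
  not_mem_bot (h ▸ mem_inf.2 ⟨hb, hc⟩)

/-- The closure of a left ideal that has a complement up to density. -/
def closure (K L : Set (List A)) (hK : IsLeftIdeal K) (hL : IsLeftIdeal L)
    (hd : ∀ w ∈ K, w ∉ L) (hc : ∀ w, Covers (K ∪ L) w) : Clopen A where
  carrier := {w | Covers K w}
  isClosedIdeal := hK.isClosedIdeal_covers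
  decided w := (hc w).mono <| by
    rintro w (hw | hw)
    · exact .inl (.mem hw)
    · refine .inr fun u hu => Covers.false_of_empty (w := u ++ w) ?_
      exact Covers.bind hu fun v hv => absurd (hL v _ (hL u w hw)) (hd _ hv)

/-- The clopen set of words extending `w`. -/
def cone (w : List A) : Clopen A :=
  closure {v | ∃ u, v = u ++ w} (exterior {v | ∃ u, v = u ++ w})
    (by rintro v _ ⟨u, rfl⟩; exact ⟨v ++ u, by simp⟩) (isLeftIdeal_exterior _)
    (fun v hv h => h [] hv) (fun v => by
      -- A word at least as long as `w` extends `w` or is not extended by any extension of `w`.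
      have key : ∀ n (v : List A), w.length ≤ v.length + n → Covers
          ({v | ∃ u, v = u ++ w} ∪ exterior {v | ∃ u, v = u ++ w}) v := by
        intro n
        induction n with
        | zero =>
          intro v hv
          by_cases h : ∃ u, v = u ++ w
          · exact .mem (.inl h)
          · refine .mem (.inr fun x ⟨y, hy⟩ => h ?_)
            obtain ⟨t, -, ht⟩ | ⟨t, -, ht⟩ := List.append_eq_append_iff.1 hy
            · exact ⟨_, ht⟩
            · obtain rfl : t = [] := List.length_eq_zero_iff.1 (by
                have := congrArg List.length ht
                simp at this
                omega)
              exact ⟨[], by simpa using ht.symm⟩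
        | succ n ih => exact fun v hv => .step fun a => ih (a :: v) (by simp; omega)
      exact key w.length v (by omega))

theorem mem_cone_self (w : List A) : w ∈ cone w := .mem ⟨[], rfl⟩

theorem cone_le {w : List A} (h : w ∈ b) : cone w ≤ b := fun v hv =>
  mem_of_covers (Covers.mono hv (by rintro _ ⟨u, rfl⟩; exact append_mem h u))

end

end Clopen

/-- A family of clopens is a cover if it is jointly dense. -/
def IsCover (P : Set (Clopen A)) : Prop := ∀ w, Covers {w | ∃ b ∈ P, w ∈ b} w

theorem isLeftIdeal_iUnion (P : Set (Clopen A)) : IsLeftIdeal {w | ∃ b ∈ P, w ∈ b} :=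
  fun v _ ⟨b, hb, hw⟩ => ⟨b, hb, Clopen.append_mem hw v⟩

variable [Nonempty A]

theorem IsCover.isLUB {P : Set (Clopen A)} (h : IsCover P) : IsLUB P ⊤ := by
  refine ⟨fun _ _ => le_top, fun c hc w _ => Clopen.mem_of_covers ((h w).mono ?_)⟩
  rintro w ⟨b, hb, hw⟩
  exact hc hb hw

theorem mem_sup_iff_covers {b c : Clopen A} {w : List A} :
    w ∈ b ⊔ c ↔ Covers {w | w ∈ b ∨ w ∈ c} w := by
  refine ⟨fun h => (Clopen.covers_decided_inter b c w).bind fun u hu => .mem ?_, fun h =>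
    Clopen.mem_of_covers (h.mono ?_)⟩
  · obtain ⟨hb | hb, hc⟩ := hu
    · exact .inl hb
    · obtain hc | hc := hc
      · exact .inr hc
      · exact absurd ⟨hb, hc⟩ (Clopen.mem_sup.1 h u)
  · rintro w (h | h)
    exacts [(le_sup_left : b ≤ b ⊔ c) h, (le_sup_right : c ≤ b ⊔ c) h]

/-- A finite join of clopens is the closure of their union. -/
theorem isCover_of_finite {P : Set (Clopen A)} (hf : P.Finite) (h : IsLUB P ⊤) : IsCover P := by
  classical
  have key : ∀ s : Finset (Clopen A), ∀ w ∈ s.sup id, Covers {w | ∃ b ∈ s, w ∈ b} w := by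
    intro s
    induction s using Finset.induction_on with
    | empty => exact fun w hw => absurd hw Clopen.not_mem_bot
    | insert b s _ ih =>
      intro w hw
      rw [Finset.sup_insert, mem_sup_iff_covers] at hw
      refine hw.bind fun u hu => ?_
      obtain hu | hu := hu
      · exact .mem ⟨b, by simp, hu⟩
      · refine (ih _ hu).mono ?_
        rintro v ⟨c, hc, hv⟩
        exact ⟨c, by simp [hc], hv⟩
  intro w
  refine (key hf.toFinset w ?_).mono ?_
  · rw [finset_sup_of_isLUB h hf]
    exact Clopen.mem_top
  · rintro v ⟨c, hc, hv⟩
    exact ⟨c, by simpa using hc, hv⟩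

/-- A jointly dense set of pairwise disjoint nonempty clopens. -/
structure IsCoverPartition (P : Set (Clopen A)) : Prop where
  ne_bot : ∀ c ∈ P, c ≠ ⊥
  disjoint : ∀ c ∈ P, ∀ d ∈ P, c ≠ d → c ⊓ d = ⊥
  isCover : IsCover P

theorem IsCoverPartition.eq_of_mem {P : Set (Clopen A)} (hP : IsCoverPartition P)
    {b c : Clopen A} (hb : b ∈ P) (hc : c ∈ P) {w : List A} (hwb : w ∈ b) (hwc : w ∈ c) :
    b = c := by
  by_contra h
  exact Clopen.not_mem_of_inf_eq_bot (hP.disjoint b hb c hc h) hwb hwc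

theorem IsCoverPartition.refine {P : Set (Clopen A)} (hP : IsCoverPartition P)
    {Q : Clopen A → Set (Clopen A)} (hQ : ∀ b ∈ P, IsCoverPartition (Q b)) :
    IsCoverPartition {d : Clopen A | d ≠ ⊥ ∧ ∃ b ∈ P, ∃ c ∈ Q b, b ⊓ c = d} where
  ne_bot _ h := h.1
  disjoint := by
    rintro _ ⟨_, b, hb, c, hc, rfl⟩ _ ⟨_, b', hb', c', hc', rfl⟩ hne
    refine Clopen.eq_bot_iff_forall.2 fun w hw => hne ?_
    obtain rfl := hP.eq_of_mem hb hb' hw.1.1 hw.2.1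
    rw [(hQ b hb).eq_of_mem hc hc' hw.1.2 hw.2.2]
  isCover w := by
    refine (hP.isCover w).bind fun u hu => ?_
    obtain ⟨b, hb, hu⟩ := hu
    refine ((hQ b hb).isCover (u ++ w)).bind fun v hv => .mem ?_
    obtain ⟨c, hc, hv⟩ := hv
    refine ⟨b ⊓ c, ⟨fun h => ?_, b, hb, c, hc, rfl⟩, Clopen.append_mem hu v, hv⟩
    exact Clopen.not_mem_of_inf_eq_bot h (Clopen.append_mem hu v) hv

theorem IsCoverPartition.coarsen {P : Set (Clopen A)} (hP : IsCoverPartition P)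
    (I : Type u) (α : P → I) (hα : Function.Surjective α) :
    ∃ j : I → Clopen A, (∀ i, IsLUB (Subtype.val '' (α ⁻¹' {i})) (j i)) ∧
      IsCoverPartition (Set.range j) := by
  have hl : ∀ s : Set P, IsLeftIdeal {w | ∃ b ∈ s, w ∈ (b : Clopen A)} :=
    fun s v _ ⟨b, hb, hw⟩ => ⟨b, hb, Clopen.append_mem hw v⟩
  have hd : ∀ i, ∀ w ∈ {w | ∃ b ∈ α ⁻¹' {i}, w ∈ (b : Clopen A)},
      w ∉ {w | ∃ b ∈ (α ⁻¹' {i})ᶜ, w ∈ (b : Clopen A)} := by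
    rintro i w ⟨b, hb, hw⟩ ⟨c, hc, hw'⟩
    exact hc (Subtype.ext (hP.eq_of_mem b.2 c.2 hw hw') ▸ hb)
  let j : I → Clopen A := fun i => Clopen.closure _ _ (hl (α ⁻¹' {i})) (hl (α ⁻¹' {i})ᶜ) (hd i)
    fun w => (hP.isCover w).mono <| by
      rintro w ⟨b, hb, hw⟩
      by_cases h : (⟨b, hb⟩ : P) ∈ α ⁻¹' {i}
      · exact .inl ⟨_, h, hw⟩
      · exact .inr ⟨_, h, hw⟩
  have hj : ∀ i, ∀ b : P, α b = i → (b : Clopen A) ≤ j i := fun i b hb w hw => .mem ⟨b, hb, hw⟩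
  refine ⟨j, fun i => ⟨?_, fun c hc w hw => ?_⟩, ⟨?_, ?_, fun w => ?_⟩⟩
  · rintro _ ⟨b, hb, rfl⟩
    exact hj i b hb
  · refine Clopen.mem_of_covers (Covers.mono hw ?_)
    rintro v ⟨b, hb, hv⟩
    exact hc ⟨b, hb, rfl⟩ hv
  · rintro _ ⟨i, rfl⟩ h
    obtain ⟨b, hb⟩ := hα i
    exact hP.ne_bot b b.2 (le_bot_iff.1 (h ▸ hj i b hb))
  · rintro _ ⟨i, rfl⟩ _ ⟨k, rfl⟩ hne
    refine Clopen.eq_bot_iff_forall.2 fun w hw => Covers.false_of_empty (w := w) ?_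
    refine (Covers.inter hw.1 hw.2 (hl _) (hl _)).bind fun u hu => ?_
    obtain ⟨⟨b, hb, hub⟩, ⟨c, hc, huc⟩⟩ := hu
    obtain rfl : b = c := Subtype.ext (hP.eq_of_mem b.2 c.2 hub huc)
    exact absurd (congrArg j (hb.symm.trans hc)) hne
  · refine (hP.isCover w).mono ?_
    rintro v ⟨b, hb, hv⟩
    exact ⟨j (α ⟨b, hb⟩), ⟨_, rfl⟩, hj _ ⟨b, hb⟩ rfl hv⟩

variable (A) in
/-- The topology of all jointly dense partitions into clopens. When `A` is infinite it contains
infinite partitions, such as that into the cones of the letters. -/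
def clopenTopology : ZeroDimTopology (Clopen A) where
  parts := {P | IsCoverPartition P}
  isPartition _ hP := ⟨hP.ne_bot, hP.disjoint, hP.isCover.isLUB⟩
  finite_mem _ hf hP := ⟨hP.ne_bot, hP.disjoint, isCover_of_finite hf hP.isLUB⟩
  refine_mem _ hP _ hQ := hP.refine hQ
  coarsen_mem _ hP := hP.coarsen

end Clopens

/-! ### Coordinates and patching in Nekrashevych algebras -/

section Algebras

variable {P A : Type u} [Monoid P] {δ : SelfSimilarAction P A}

namespace Alg

variable (X : Alg δ)

/-- The component `x_w` of `x` at a word `w`, obtained by iterating `X ≅ X^A`. -/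
def coord (x : X.carrier) : List A → X.carrier
  | [] => x
  | a :: w => X.iso (coord x w) a

/-- The element with prescribed components at the letters. -/
def node (f : A → X.carrier) : X.carrier := X.iso.symm f

variable {X} {x y : X.carrier}

theorem iso_node (f : A → X.carrier) (a : A) : X.iso (X.node f) a = f a :=
  congrFun (X.iso.apply_symm_apply f) a

theorem node_iso (x : X.carrier) : X.node (X.iso x) = x := X.iso.symm_apply_apply x

theorem coord_append (x : X.carrier) (u w : List A) :
    X.coord x (u ++ w) = X.coord (X.coord x w) u := by
  induction u with
  | nil => rfl
  | cons a u ih => exact congrArg (X.iso · a) ih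

theorem coord_smul (p : P) (x : X.carrier) (w : List A) :
    X.coord (p • x) w = δ.resWord p w • X.coord x (δ.actWord p w) := by
  induction w with
  | nil => rfl
  | cons a w ih =>
    change X.iso (X.coord (p • x) w) a = _
    rw [ih, X.iso_smul]
    rfl

theorem Hom.map_coord {X Y : Alg δ} (f : Alg.Hom X Y) (x : X.carrier) (w : List A) :
    f.toFun (X.coord x w) = Y.coord (f.toFun x) w := by
  induction w with
  | nil => rfl
  | cons a w ih =>
    change f.toFun (X.iso (X.coord x w) a) = Y.iso (Y.coord (f.toFun x) w) a
    rw [← ih, f.map_iso]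

theorem coord_eq_of_covers {w : List A} (h : Covers {w | X.coord x w = X.coord y w} w) :
    X.coord x w = X.coord y w := by
  induction h with
  | mem hw => exact hw
  | step _ ih => exact X.iso.injective (funext ih)

/-- An element is determined by its components at a dense family of words. -/
theorem ext_of_covers (h : Covers {w | X.coord x w = X.coord y w} []) : x = y :=
  coord_eq_of_covers h

/-- Compatible elements over a dense left ideal can be patched. -/
theorem exists_patch {I : Set (List A)} (hI : IsLeftIdeal I) (s : List A → X.carrier)
    (hs : ∀ w ∈ I, ∀ a, X.iso (s w) a = s (a :: w)) {w : List A} (hw : Covers I w) :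
    ∃ z, ∀ u, u ++ w ∈ I → X.coord z u = s (u ++ w) := by
  have base : ∀ w ∈ I, ∀ u, X.coord (s w) u = s (u ++ w) := by
    intro w hw u
    induction u with
    | nil => rfl
    | cons a u ih =>
      change X.iso (X.coord (s w) u) a = s (a :: (u ++ w))
      rw [ih, hs _ (hI u w hw)]
  induction hw with
  | mem hw => exact ⟨_, fun u _ => base _ hw u⟩
  | @step w _ ih =>
    by_cases hw : w ∈ I
    · exact ⟨_, fun u _ => base _ hw u⟩
    choose z hz using ih
    refine ⟨X.node z, fun u hu => ?_⟩
    obtain rfl | ⟨u, a, rfl⟩ := u.eq_nil_or_concat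
    · exact absurd hu hw
    · rw [List.concat_eq_append, coord_append]
      change X.coord (X.iso (X.node z) a) u = _
      rw [iso_node, hz a u (by simpa using hu)]
      simp

/-- Every element is the component at `v` of some element. -/
theorem exists_coord_eq (v : List A) (y : X.carrier) : ∃ x, X.coord x v = y := by
  induction v generalizing y with
  | nil => exact ⟨y, rfl⟩
  | cons a v ih =>
    obtain ⟨x, hx⟩ := ih (X.node fun _ => y)
    refine ⟨x, ?_⟩
    change X.iso (X.coord x v) a = y
    rw [hx, iso_node]

theorem exists_patch_partition [Nonempty A] {Q : Set (Clopen A)} (hQ : IsCoverPartition Q)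
    (f : Q → X.carrier) : ∃ z, ∀ b : Q, ∀ w ∈ (b : Clopen A), X.coord z w = X.coord (f b) w := by
  classical
  have h0 : ∀ b : Q, ∀ w ∈ (b : Clopen A), ∀ h : ∃ b : Q, w ∈ (b : Clopen A), h.choose = b :=
    fun b w hw h => Subtype.ext (hQ.eq_of_mem h.choose.2 b.2 h.choose_spec hw)
  by_cases hX : Nonempty X.carrier
  · let s : List A → X.carrier := fun w =>
      if h : ∃ b : Q, w ∈ (b : Clopen A) then X.coord (f h.choose) w else Classical.arbitrary _
    have hs : ∀ b : Q, ∀ w ∈ (b : Clopen A), s w = X.coord (f b) w := fun b w hw => by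
      have h : ∃ b : Q, w ∈ (b : Clopen A) := ⟨b, hw⟩
      simp only [s, dif_pos h, h0 b w hw h]
    obtain ⟨z, hz⟩ := exists_patch (isLeftIdeal_iUnion Q) s (fun w hw a => by
      obtain ⟨b, hb, hw⟩ := hw
      rw [hs ⟨b, hb⟩ w hw, hs ⟨b, hb⟩ (a :: w) (Clopen.append_mem hw [a])]
      rfl) (hQ.isCover [])
    refine ⟨z, fun b w hw => ?_⟩
    rw [← hs b w hw]
    simpa using hz w ⟨b, b.2, by simpa using hw⟩
  · refine (?_ : False).elim
    refine Covers.false_of_empty (w := ([] : List A)) ((hQ.isCover []).mono ?_)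
    rintro w ⟨b, hb, -⟩
    exact hX ⟨f ⟨b, hb⟩⟩

theorem exists_cond [Nonempty A] (b : Clopen A) (x y : X.carrier) :
    ∃ z, (∀ w ∈ b, X.coord z w = X.coord x w) ∧ ∀ w ∈ bᶜ, X.coord z w = X.coord y w := by
  classical
  let s : List A → X.carrier := fun w => if w ∈ b then X.coord x w else X.coord y w
  have hs : ∀ w ∈ b, s w = X.coord x w := fun w hw => if_pos hw
  have hs' : ∀ w ∈ bᶜ, s w = X.coord y w := fun w hw => if_neg (hw [])
  obtain ⟨z, hz⟩ := exists_patch b.isLeftIdeal_decided s (fun w hw a => by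
    obtain hw | hw := hw
    · rw [hs w hw, hs (a :: w) (Clopen.append_mem hw [a])]
      rfl
    · rw [hs' w hw, hs' (a :: w) (Clopen.append_mem (b := bᶜ) hw [a])]
      rfl) (b.decided [])
  refine ⟨z, fun w hw => ?_, fun w hw => ?_⟩
  · rw [← hs w hw]
    simpa using hz w (by simpa using Or.inl hw)
  · rw [← hs' w hw]
    simpa using hz w (by simpa using Or.inr (Clopen.mem_compl.1 hw))

section

variable [Nonempty A]

variable (X) in
/-- The element equal to `x` on `b` and to `y` off `b`. -/
noncomputable def cond (b : Clopen A) (x y : X.carrier) : X.carrier := (exists_cond b x y).choose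

variable {b c : Clopen A} {w : List A}

theorem coord_cond_of_mem (hw : w ∈ b) : X.coord (X.cond b x y) w = X.coord x w :=
  (exists_cond b x y).choose_spec.1 w hw

theorem coord_cond_of_mem_compl (hw : w ∈ bᶜ) : X.coord (X.cond b x y) w = X.coord y w :=
  (exists_cond b x y).choose_spec.2 w hw

theorem ext_clopen (b : Clopen A) (h : ∀ w ∈ b, X.coord x w = X.coord y w)
    (h' : ∀ w ∈ bᶜ, X.coord x w = X.coord y w) : x = y :=
  ext_of_covers ((b.covers_compl []).mono fun w hw => hw.elim (h w) (h' w))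

theorem ext_partition {Q : Set (Clopen A)} (hQ : IsCoverPartition Q)
    (h : ∀ b ∈ Q, ∀ w ∈ b, X.coord x w = X.coord y w) : x = y :=
  ext_of_covers ((hQ.isCover []).mono fun w ⟨b, hb, hw⟩ => h b hb w hw)

theorem cond_eq_iff : X.cond b x y = y ↔ ∀ w ∈ b, X.coord x w = X.coord y w := by
  refine ⟨fun h w hw => ?_, fun h => ?_⟩
  · rw [← coord_cond_of_mem (y := y) hw, h]
  · exact ext_clopen b (fun w hw => (coord_cond_of_mem hw).trans (h w hw))
      fun w hw => coord_cond_of_mem_compl hw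

variable (X) in
/-- The patching structure of a Nekrashevych algebra over the clopens. -/
noncomputable def bj : BJStructure (clopenTopology A) X.carrier where
  cond := X.cond
  cond_self b x := ext_clopen b (fun _ hw => coord_cond_of_mem hw)
    fun _ hw => coord_cond_of_mem_compl hw
  cond_left b x y z := ext_clopen b
    (fun w hw => by rw [coord_cond_of_mem hw, coord_cond_of_mem hw, coord_cond_of_mem hw])
    fun w hw => by rw [coord_cond_of_mem_compl hw, coord_cond_of_mem_compl hw]
  cond_right b x y z := ext_clopen b
    (fun w hw => by rw [coord_cond_of_mem hw, coord_cond_of_mem hw])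
    fun w hw => by
      rw [coord_cond_of_mem_compl hw, coord_cond_of_mem_compl hw, coord_cond_of_mem_compl hw]
  cond_top x y := ext_of_covers (.mem (coord_cond_of_mem Clopen.mem_top))
  cond_compl b x y := ext_clopen b
    (fun w hw => by
      rw [coord_cond_of_mem hw, coord_cond_of_mem_compl (by rwa [compl_compl])])
    fun w hw => by rw [coord_cond_of_mem_compl hw, coord_cond_of_mem hw]
  cond_inf b c x y := ext_clopen b
    (fun w hw => by
      rw [coord_cond_of_mem hw]
      refine coord_eq_of_covers ((c.covers_compl w).bind fun u hu => .mem ?_)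
      change X.coord _ _ = X.coord _ _
      obtain hu | hu := hu
      · rw [coord_cond_of_mem hu,
          coord_cond_of_mem (Clopen.mem_inf.2 ⟨Clopen.append_mem hw u, hu⟩)]
      · rw [coord_cond_of_mem_compl hu, coord_cond_of_mem_compl
          ((compl_le_compl inf_le_right : cᶜ ≤ (b ⊓ c)ᶜ) hu)])
    fun w hw => by
      rw [coord_cond_of_mem_compl hw, coord_cond_of_mem_compl
        ((compl_le_compl inf_le_left : bᶜ ≤ (b ⊓ c)ᶜ) hw)]
  glue Q hQ _ f := (exists_patch_partition hQ f).choose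
  glue_const Q hQ _ x := ext_partition hQ fun b hb w hw =>
    (exists_patch_partition hQ fun _ => x).choose_spec ⟨b, hb⟩ w hw
  glue_cond Q hQ _ x y := ext_partition hQ fun b hb w hw => by
    rw [(exists_patch_partition hQ x).choose_spec ⟨b, hb⟩ w hw,
      (exists_patch_partition hQ _).choose_spec ⟨b, hb⟩ w hw, coord_cond_of_mem hw]
  cond_glue Q hQ _ x b := cond_eq_iff.2 ((exists_patch_partition hQ x).choose_spec b)

theorem bj_rel {x y : X.carrier} : X.bj.Rel b x y ↔ ∀ w ∈ b, X.coord x w = X.coord y w :=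
  cond_eq_iff

end

/-! ### Free Nekrashevych algebras -/

/-- Terms in the operations of Nekrashevych algebras over a set `S` of variables. -/
inductive FreeTerm (δ : SelfSimilarAction P A) (S : Type u) : Type u
  | gen (s : S)
  | smul (p : P) (t : FreeTerm δ S)
  | proj (a : A) (t : FreeTerm δ S)
  | node (f : A → FreeTerm δ S)

/-- Provable equality of terms. -/
inductive FreeTerm.Eqv {S : Type u} : FreeTerm δ S → FreeTerm δ S → Prop
  | refl (t) : Eqv t t
  | symm {t t'} : Eqv t t' → Eqv t' t
  | trans {t t' t''} : Eqv t t' → Eqv t' t'' → Eqv t t''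
  | smul (p : P) {t t'} : Eqv t t' → Eqv (.smul p t) (.smul p t')
  | proj (a : A) {t t'} : Eqv t t' → Eqv (.proj a t) (.proj a t')
  | node {f g : A → FreeTerm δ S} : (∀ a, Eqv (f a) (g a)) → Eqv (.node f) (.node g)
  | one_smul (t) : Eqv (.smul 1 t) t
  | mul_smul (p q : P) (t) : Eqv (.smul (p * q) t) (.smul p (.smul q t))
  | proj_smul (a : A) (p : P) (t) :
    Eqv (.proj a (.smul p t)) (.smul (δ.res p a) (.proj (δ.act a p) t))
  | proj_node (a : A) (f : A → FreeTerm δ S) : Eqv (.proj a (.node f)) (f a)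
  | node_proj (t) : Eqv (.node fun a => .proj a t) t

variable (δ) in
/-- Provable equality as a setoid. -/
def FreeTerm.setoid (S : Type u) : Setoid (FreeTerm δ S) :=
  ⟨FreeTerm.Eqv, ⟨.refl, .symm, .trans⟩⟩

variable (δ) in
/-- The free Nekrashevych algebra on a set. -/
noncomputable def free (S : Type u) : Alg δ where
  carrier := Quotient (FreeTerm.setoid δ S)
  action :=
    { smul := fun p => Quotient.map' (.smul p) fun _ _ h => .smul p h
      one_smul := fun x => Quotient.inductionOn x fun t => Quotient.sound (.one_smul t)
      mul_smul := fun p q x => Quotient.inductionOn x fun t => Quotient.sound (.mul_smul p q t) }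
  iso :=
    { toFun := fun x a => Quotient.map' (.proj a) (fun _ _ h => .proj a h) x
      invFun := fun f => Quotient.mk _ (.node fun a => (f a).out)
      left_inv := fun x => Quotient.inductionOn x fun t => Quotient.sound <|
        (FreeTerm.Eqv.node fun _ => Quotient.mk_out (s := FreeTerm.setoid δ S) _).trans
          (.node_proj t)
      right_inv := fun _ => funext fun a => (Quotient.sound (FreeTerm.Eqv.proj_node a _)).trans
        (Quotient.out_eq _) }
  iso_smul p x := funext fun a => Quotient.inductionOn x fun t =>
    Quotient.sound (.proj_smul a p t)

variable (δ) in
/-- The generators of the free algebra. -/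
def gen {S : Type u} (s : S) : (free δ S).carrier := Quotient.mk _ (.gen s)

theorem free_induction {S : Type u} {Q : (free δ S).carrier → Prop} (t : (free δ S).carrier)
    (gen : ∀ s, Q (gen δ s)) (smul : ∀ (p : P) x, Q x → Q (p • x))
    (proj : ∀ a x, Q x → Q ((free δ S).iso x a))
    (node : ∀ f : A → (free δ S).carrier, (∀ a, Q (f a)) → Q ((free δ S).node f)) : Q t := by
  induction t using Quotient.inductionOn with | _ t
  induction t with
  | gen s => exact gen s
  | smul p t ih => exact smul p _ ih
  | proj a t ih => exact proj a _ ih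
  | node f ih =>
    have h : (Quotient.mk (FreeTerm.setoid δ S) (.node f) : (free δ S).carrier) =
        (free δ S).node fun a => Quotient.mk _ (f a) := by
      refine (Equiv.eq_symm_apply (free δ S).iso).2 (funext fun a => ?_)
      exact Quotient.sound (s := FreeTerm.setoid δ S) (FreeTerm.Eqv.proj_node a f)
    rw [h]
    exact node _ ih

theorem free_hom_ext {S : Type u} {f g : Alg.Hom (free δ S) X}
    (h : ∀ s, f.toFun (gen δ s) = g.toFun (gen δ s)) (t : (free δ S).carrier) :
    f.toFun t = g.toFun t := by
  induction t using free_induction with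
  | gen s => exact h s
  | smul p x ih => rw [f.map_smul, g.map_smul, ih]
  | proj a x ih => rw [← f.map_iso, ← g.map_iso, ih]
  | node k ih =>
    refine X.iso.injective (funext fun a => ?_)
    rw [f.map_iso, g.map_iso, iso_node, ih]

/-- The value of a term under an assignment of its variables. -/
def FreeTerm.eval {S : Type u} (x : S → X.carrier) : FreeTerm δ S → X.carrier
  | .gen s => x s
  | .smul p t => p • t.eval x
  | .proj a t => X.iso (t.eval x) a
  | .node f => X.node fun a => (f a).eval x

theorem FreeTerm.Eqv.eval_eq {S : Type u} (x : S → X.carrier) {t t' : FreeTerm δ S}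
    (h : t.Eqv t') : t.eval x = t'.eval x := by
  induction h with
  | refl => rfl
  | symm _ ih => exact ih.symm
  | trans _ _ ih ih' => exact ih.trans ih'
  | smul p _ ih => exact congrArg (p • ·) ih
  | proj a _ ih => exact congrArg (X.iso · a) ih
  | node _ ih => exact congrArg X.node (funext ih)
  | one_smul t => exact MulAction.one_smul _
  | mul_smul p q t => exact SemigroupAction.mul_smul p q _
  | proj_smul a p t => exact congrFun (X.iso_smul p _) a
  | proj_node a f => exact iso_node _ a
  | node_proj t => exact node_iso _

/-- The universal property of the free algebra. -/
def lift {S : Type u} (x : S → X.carrier) : Alg.Hom (free δ S) X where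
  toFun := Quotient.lift (FreeTerm.eval x) fun _ _ h => FreeTerm.Eqv.eval_eq x h
  map_smul _ t := Quotient.inductionOn t fun _ => rfl
  map_iso t _ := Quotient.inductionOn t fun _ => rfl

/-- The words at which `t` is a multiple of a component of a variable. -/
def reduced {S : Type u} (t : (free δ S).carrier) : Set (List A) :=
  {w | ∃ (q : P) (v : List A) (s : S), (free δ S).coord t w = q • (free δ S).coord (gen δ s) v}

theorem isLeftIdeal_reduced {S : Type u} (t : (free δ S).carrier) : IsLeftIdeal (reduced t) := by
  rintro u w ⟨q, v, s, h⟩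
  refine ⟨δ.resWord q u, δ.actWord q u ++ v, s, ?_⟩
  rw [coord_append, h, coord_smul, coord_append]

/-- Every element of a free algebra is, densely, a multiple of a component of a generator. -/
theorem covers_reduced {S : Type u} (t : (free δ S).carrier) : Covers (reduced t) [] := by
  induction t using free_induction with
  | gen s => exact .mem ⟨1, [], s, (one_smul P _).symm⟩
  | smul p t ih =>
    refine (Covers.actWord (δ := δ) (p := p) ih).mono ?_
    rintro w ⟨q, v, s, h⟩
    exact ⟨δ.resWord p w * q, v, s, by rw [coord_smul, h, mul_smul]⟩
  | proj a t ih =>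
    have h := ih.append (isLeftIdeal_reduced t) [a]
    refine (Covers.of_append (u := []) (w := [a]) h).mono ?_
    rintro w ⟨q, v, s, h⟩
    exact ⟨q, v, s, by rw [← h, coord_append]; rfl⟩
  | node f ih =>
    refine .step fun a => Covers.append_right (u := []) (w := [a]) ((ih a).mono ?_)
    rintro w ⟨q, v, s, h⟩
    refine ⟨q, v, s, ?_⟩
    rw [← h, coord_append]
    exact congrArg (fun y => (free δ S).coord y w) (iso_node f a)

theorem covers_reduced' {S : Type u} (t : (free δ S).carrier) (w : List A) :
    Covers (reduced t) w := by
  simpa using (covers_reduced t).append (isLeftIdeal_reduced t) w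

end Alg

/-! ### The algebra of functions on graded streams -/

section Streams

/-- The first `k` letters of a stream, the letter with index `0` standing at the end. -/
def prefixWord (s : ℕ → A) : ℕ → List A
  | 0 => []
  | k + 1 => s k :: prefixWord s k

/-- Prepending a letter to a stream. -/
def consStream (a : A) (s : ℕ → A) : ℕ → A
  | 0 => a
  | k + 1 => s k

/-- Prepending a word to a stream. -/
def appendStream : List A → (ℕ → A) → ℕ → A
  | [], s => s
  | a :: w, s => appendStream w (consStream a s)

theorem prefixWord_consStream (a : A) (s : ℕ → A) (k : ℕ) :
    prefixWord (consStream a s) (k + 1) = prefixWord s k ++ [a] := by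
  induction k with
  | zero => rfl
  | succ k ih =>
    change s k :: prefixWord (consStream a s) (k + 1) = _
    rw [ih]
    rfl

theorem prefixWord_appendStream (w : List A) (s : ℕ → A) (k : ℕ) :
    prefixWord (appendStream w s) (w.length + k) = prefixWord s k ++ w := by
  induction w generalizing s k with
  | nil => simp [appendStream]
  | cons a w ih =>
    have h := ih (consStream a s) (k + 1)
    rw [prefixWord_consStream, List.append_assoc] at h
    rw [List.length_cons, add_assoc, add_comm 1 k]
    exact h

namespace SelfSimilarAction

variable (δ)

/-- The action on streams extending that on words. -/
def actStream (p : P) (s : ℕ → A) : ℕ → A := fun k =>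
  δ.act (s k) (δ.resWord p (prefixWord s k))

theorem prefixWord_actStream (p : P) (s : ℕ → A) (k : ℕ) :
    prefixWord (δ.actStream p s) k = δ.actWord p (prefixWord s k) := by
  induction k with
  | zero => rfl
  | succ k ih => exact congrArg (_ :: ·) ih

theorem actStream_one (s : ℕ → A) : δ.actStream 1 s = s := by
  funext k
  rw [actStream, resWord_one, act_one]

theorem actStream_mul (p q : P) (s : ℕ → A) :
    δ.actStream (p * q) s = δ.actStream q (δ.actStream p s) := by
  funext k
  rw [actStream, actStream, resWord_mul, act_mul, prefixWord_actStream]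
  rfl

theorem actStream_consStream (p : P) (a : A) (s : ℕ → A) :
    δ.actStream p (consStream a s) = consStream (δ.act a p) (δ.actStream (δ.res p a) s) := by
  funext k
  cases k with
  | zero => rfl
  | succ k =>
    rw [actStream, prefixWord_consStream, resWord_append]
    rfl

end SelfSimilarAction

variable (δ) in
/-- The functions on streams graded by the integers, where taking a component shifts the grading.
The grading records the length of words, which the action on streams alone may forget. -/
def streamAlg (S : Type u) : Alg δ where
  carrier := (ℕ → A) × ℤ → S
  action :=
    { smul := fun p φ s => φ (δ.actStream p s.1, s.2)
      one_smul := fun φ => funext fun s => congrArg (fun t => φ (t, s.2)) (δ.actStream_one s.1)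
      mul_smul := fun p q φ => funext fun s =>
        congrArg (fun t => φ (t, s.2)) (δ.actStream_mul p q s.1) }
  iso :=
    { toFun := fun φ a s => φ (consStream a s.1, s.2 + 1)
      invFun := fun ψ s => ψ (s.1 0) (fun k => s.1 (k + 1), s.2 - 1)
      left_inv := fun φ => funext fun s => congrArg φ <| Prod.ext
        (funext fun k => by cases k <;> rfl) (sub_add_cancel s.2 1)
      right_inv := fun ψ => funext fun a => funext fun s => congrArg (ψ a) <|
        Prod.ext rfl (add_sub_cancel_right s.2 1) }
  iso_smul p φ := funext fun a => funext fun s =>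
    congrArg (fun t => φ (t, s.2 + 1)) (δ.actStream_consStream p a s.1)

theorem streamAlg_coord {S : Type u} (φ : (ℕ → A) × ℤ → S) (w : List A) (s : ℕ → A) (n : ℤ) :
    ((streamAlg δ S).coord φ w : (ℕ → A) × ℤ → S) (s, n) = φ (appendStream w s, n + w.length) := by
  induction w generalizing s n with
  | nil => simp [appendStream, Alg.coord]
  | cons a w ih =>
    refine (ih (consStream a s) (n + 1)).trans (congrArg φ (Prod.ext rfl ?_))
    simp only [List.length_cons]
    push_cast
    ring

/-- The generic function on graded streams. -/
def genericStream : (streamAlg δ ((ℕ → A) × ℤ)).carrier := id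

/-- The generic function separates the multiples of its components, up to the kernel of the action
on words. -/
theorem genericStream_separates [Nonempty A] {q q' : P} {v v' : List A}
    (h : q • (streamAlg δ _).coord genericStream v = q' • (streamAlg δ _).coord genericStream v') :
    v = v' ∧ ∀ w, δ.actWord q w = δ.actWord q' w := by
  have h1 : ∀ s : ℕ → A, appendStream v (δ.actStream q s) = appendStream v' (δ.actStream q' s) ∧
      v.length = v'.length := by
    intro s
    have h2 := (streamAlg_coord (δ := δ) id v (δ.actStream q s) 0).symm.trans
      ((congrFun h (s, 0)).trans (streamAlg_coord id v' (δ.actStream q' s) 0))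
    obtain ⟨h3, h4⟩ := Prod.mk.inj h2
    exact ⟨h3, by simpa using h4⟩
  have h2 : ∀ s k, δ.actWord q (prefixWord s k) ++ v = δ.actWord q' (prefixWord s k) ++ v' := by
    intro s k
    rw [← δ.prefixWord_actStream, ← δ.prefixWord_actStream, ← prefixWord_appendStream,
      ← prefixWord_appendStream, (h1 s).1, (h1 s).2]
  obtain ⟨s₀⟩ : Nonempty (ℕ → A) := inferInstance
  have hv : v = v' := h2 s₀ 0
  refine ⟨hv, fun w => ?_⟩
  have h3 := h2 (appendStream w s₀) w.length
  have h4 : prefixWord (appendStream w s₀) w.length = w := prefixWord_appendStream w s₀ 0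
  rw [h4, hv] at h3
  exact List.append_cancel_right h3

end Streams

end Algebras

/-! ### The algebra of clopens -/

section ClopenAlgebra

variable {P A : Type u} [Monoid P]

namespace Clopen

variable {b c : Clopen A}

theorem isLeftIdeal (b : Clopen A) : IsLeftIdeal (b : Set (List A)) := b.isClosedIdeal.1

/-- The clopen of the words `u` with `u ++ w ∈ b`. -/
def restrict (b : Clopen A) (w : List A) : Clopen A where
  carrier := {u | u ++ w ∈ b}
  isClosedIdeal := ⟨fun v u hu => by
    change (v ++ u) ++ w ∈ b
    rw [List.append_assoc]
    exact append_mem hu v, fun u hu => b.isClosedIdeal.2 _ hu⟩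
  decided u := (Covers.of_append (b.decided (u ++ w))).mono <| by
    rintro u (hu | hu)
    · exact .inl hu
    · refine .inr fun v hv => hu v ?_
      rw [← List.append_assoc]
      exact hv

theorem mem_restrict {u w : List A} : u ∈ b.restrict w ↔ u ++ w ∈ b := Iff.rfl

theorem restrict_inf (b c : Clopen A) (w : List A) :
    (b ⊓ c).restrict w = b.restrict w ⊓ c.restrict w := rfl

theorem ext_restrict (h : ∀ a, b.restrict [a] = c.restrict [a]) : b = c := by
  have aux : ∀ b c : Clopen A, (∀ a, b.restrict [a] = c.restrict [a]) → b ≤ c := by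
    intro b c h w hw
    have key : ∀ u a, u ++ [a] ∈ b → u ++ [a] ∈ c := fun u a hu => by
      rw [← mem_restrict, ← h a]
      exact hu
    refine c.isClosedIdeal.2 w fun a => ?_
    obtain ⟨u, a', hu⟩ := (a :: w).eq_nil_or_concat.resolve_left (by simp)
    have h1 : a :: w ∈ b := append_mem hw [a]
    rw [hu, List.concat_eq_append] at h1
    change a :: w ∈ c
    rw [hu, List.concat_eq_append]
    exact key u a' h1
  exact le_antisymm (aux b c h) (aux c b fun a => (h a).symm)

variable [Nonempty A]

theorem restrict_compl (b : Clopen A) (w : List A) : bᶜ.restrict w = (b.restrict w)ᶜ := by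
  refine SetLike.ext fun u => forall_congr' fun v => ?_
  rw [← List.append_assoc]
  rfl

theorem restrict_sup (b c : Clopen A) (w : List A) :
    (b ⊔ c).restrict w = b.restrict w ⊔ c.restrict w := by
  rw [← compl_compl (b ⊔ c), compl_sup, restrict_compl, restrict_inf, restrict_compl,
    restrict_compl, compl_inf, compl_compl, compl_compl]

theorem restrict_eq_top {w : List A} : b.restrict w = ⊤ ↔ w ∈ b := by
  refine ⟨fun h => ?_, fun h => top_le_iff.1 fun u _ => append_mem h u⟩
  have h1 : ([] : List A) ∈ b.restrict w := h ▸ mem_top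
  exact h1

theorem restrict_eq_bot {w : List A} (hw : w ∈ bᶜ) : b.restrict w = ⊥ := by
  rw [← compl_compl (b.restrict w), ← restrict_compl, restrict_eq_top.2 hw, compl_top]

theorem exists_restrict (f : A → Clopen A) : ∃ b : Clopen A, ∀ a, b.restrict [a] = f a := by
  have hl : ∀ s : A → Set (List A), (∀ a, IsLeftIdeal (s a)) →
      IsLeftIdeal {v | ∃ a, ∃ u ∈ s a, v = u ++ [a]} := by
    rintro s hs v _ ⟨a, u, hu, rfl⟩
    exact ⟨a, v ++ u, hs a v u hu, by simp⟩
  have hK := hl (fun a => f a) fun a => (f a).isLeftIdeal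
  have hL := hl (fun a => exterior (f a)) fun a => isLeftIdeal_exterior _
  refine ⟨closure _ _ hK hL ?_ fun w => ?_, fun a => SetLike.ext fun u => ?_⟩
  · rintro _ ⟨a, u, hu, rfl⟩ ⟨a', u', hu', h⟩
    obtain ⟨rfl, h⟩ := List.append_inj' h rfl
    obtain rfl : a = a' := by simpa using h
    exact hu' [] hu
  · have h : Covers ({v | ∃ a, ∃ u ∈ (f a : Set (List A)), v = u ++ [a]} ∪
        {v | ∃ a, ∃ u ∈ exterior (f a : Set (List A)), v = u ++ [a]}) [] := by
      refine .step fun a => Covers.append_right (u := []) (w := [a]) (((f a).decided []).mono ?_)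
      rintro u (hu | hu)
      · exact .inl ⟨a, u, hu, rfl⟩
      · exact .inr ⟨a, u, hu, rfl⟩
    simpa using h.append (hK.union hL) w
  · refine ⟨fun h => ?_, fun h => .mem ⟨a, u, h, rfl⟩⟩
    refine mem_of_covers ((Covers.of_append (w := [a]) h).mono ?_)
    rintro v ⟨a', u', hu', h⟩
    obtain ⟨rfl, h⟩ := List.append_inj' h rfl
    obtain rfl : a = a' := by simpa using h
    exact hu'

variable (δ : SelfSimilarAction P A)

/-- The inverse image of a clopen along `- ⋆ p`, followed by closure since `- ⋆ p` need not be
surjective. -/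
def preimage (p : P) (b : Clopen A) : Clopen A :=
  closure {w | δ.actWord p w ∈ b} {w | δ.actWord p w ∈ bᶜ}
    (δ.isLeftIdeal_preimage b.isLeftIdeal p) (δ.isLeftIdeal_preimage bᶜ.isLeftIdeal p)
    (fun _ hw hw' => hw' [] hw) fun _ => Covers.actWord (b.decided _)

variable {δ}

theorem mem_preimage {p : P} {w : List A} :
    w ∈ preimage δ p b ↔ Covers {w | δ.actWord p w ∈ b} w := Iff.rfl

theorem preimage_inf (p : P) (b c : Clopen A) :
    preimage δ p (b ⊓ c) = preimage δ p b ⊓ preimage δ p c := by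
  refine SetLike.ext fun w => ?_
  rw [mem_inf, mem_preimage, mem_preimage, mem_preimage]
  refine ⟨fun h => ⟨h.mono fun _ h => h.1, h.mono fun _ h => h.2⟩, fun h => ?_⟩
  · exact Covers.inter h.1 h.2 (δ.isLeftIdeal_preimage b.isLeftIdeal p)
      (δ.isLeftIdeal_preimage c.isLeftIdeal p)

theorem preimage_compl (p : P) (b : Clopen A) : preimage δ p bᶜ = (preimage δ p b)ᶜ := by
  refine SetLike.ext fun w => ⟨fun h u hu => ?_, fun h => ?_⟩
  · refine Covers.false_of_empty (w := u ++ w) ?_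
    refine (Covers.inter hu (Covers.append h (δ.isLeftIdeal_preimage bᶜ.isLeftIdeal p) u)
      (δ.isLeftIdeal_preimage b.isLeftIdeal p)
      (δ.isLeftIdeal_preimage bᶜ.isLeftIdeal p)).mono ?_
    exact fun v hv => hv.2 [] hv.1
  · refine (Covers.actWord (p := p) (b.decided (δ.actWord p w))).bind fun u hu => ?_
    obtain hu | hu := hu
    · exact absurd (mem_preimage.2 (.mem hu)) (h u)
    · exact .mem hu

theorem preimage_top (p : P) : preimage δ p ⊤ = ⊤ := top_le_iff.1 fun _ _ => .mem mem_top

end Clopen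

open Clopen

variable [Nonempty A] (δ : SelfSimilarAction P A)

/-- The clopens form a Nekrashevych algebra, where `p` acts by inverse image and the components
are the restrictions. -/
@[reducible]
noncomputable def clopenAlg : Alg δ where
  carrier := Clopen A
  action :=
    { smul := preimage δ
      one_smul := fun b => SetLike.ext fun w => by
        change Covers {w | δ.actWord 1 w ∈ b} w ↔ w ∈ b
        simp only [δ.actWord_one]
        exact ⟨mem_of_covers, .mem⟩
      mul_smul := fun p q b => SetLike.ext fun w => by
        change Covers {w | δ.actWord (p * q) w ∈ b} w ↔
          Covers {w | Covers {w | δ.actWord q w ∈ b} (δ.actWord p w)} w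
        simp only [δ.actWord_mul]
        exact ⟨fun h => h.mono fun u hu => .mem hu, fun h => h.bind fun u hu => Covers.actWord hu⟩ }
  iso := Equiv.ofBijective (fun b a => b.restrict [a])
    ⟨fun _ _ h => ext_restrict fun a => congrFun h a, fun f =>
      (exists_restrict f).imp fun _ h => funext h⟩
  iso_smul p b := funext fun a => SetLike.ext fun u => by
    change Covers {w | δ.actWord p w ∈ b} (u ++ [a]) ↔
      Covers {u | δ.actWord (δ.res p a) u ++ [δ.act a p] ∈ b} u
    refine ⟨fun h => h.of_append.mono ?_, fun h => Covers.append_right (h.mono ?_)⟩ <;>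
    · intro v hv
      change δ.actWord p (v ++ [a]) ∈ b at *
      first
      | rw [δ.actWord_append] at hv; exact hv
      | rw [δ.actWord_append]; exact hv

variable {δ}

theorem clopen_coord (b : Clopen A) (w : List A) : (clopenAlg δ).coord b w = b.restrict w := by
  induction w with
  | nil =>
    refine SetLike.ext fun u => ?_
    rw [mem_restrict, List.append_nil]
    rfl
  | cons a w ih =>
    change (clopenAlg δ).iso ((clopenAlg δ).coord b w) a = _
    rw [ih]
    refine SetLike.ext fun u => ?_
    change (u ++ [a]) ++ w ∈ b ↔ u ++ (a :: w) ∈ b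
    simp

end ClopenAlgebra

/-! ### The monoid of unary operations -/

section Endo

variable {P A : Type u} [Monoid P] (δ : SelfSimilarAction P A)

/-- The monoid of unary operations of Nekrashevych algebras, with underlying set the free algebra
on one generator. -/
abbrev Endo : Type u := (Alg.free δ PUnit.{u + 1}).carrier

namespace Endo

variable {δ} {X : Alg δ}

/-- The value of a unary operation at an element. -/
def ev (m : Endo δ) (x : X.carrier) : X.carrier := (Alg.lift fun _ => x).toFun m

theorem map_ev {X Y : Alg δ} (f : Alg.Hom X Y) (m : Endo δ) (x : X.carrier) :
    f.toFun (m.ev x) = m.ev (f.toFun x) :=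
  Alg.free_hom_ext (f := ⟨f.toFun ∘ (Alg.lift fun _ => x).toFun,
    fun p t => by simp [Alg.Hom.map_smul], fun t a => by simp [Alg.Hom.map_iso]⟩)
    (g := Alg.lift fun _ => f.toFun x) (fun _ => rfl) m

noncomputable instance : Monoid (Endo δ) where
  one := Alg.gen δ PUnit.unit
  mul m n := m.ev (X := Alg.free δ PUnit) n
  mul_assoc m n k := map_ev (Alg.lift fun _ => k) m n
  one_mul _ := rfl
  mul_one m := Alg.free_hom_ext (f := Alg.lift fun _ => Alg.gen δ PUnit.unit)
    (g := ⟨id, fun _ _ => rfl, fun _ _ => rfl⟩) (fun _ => rfl) m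

theorem one_ev (x : X.carrier) : (1 : Endo δ).ev x = x := rfl

theorem mul_ev (m n : Endo δ) (x : X.carrier) : (m * n).ev x = m.ev (n.ev x) :=
  map_ev (Alg.lift fun _ => x) m n

theorem smul_ev (p : P) (m : Endo δ) (x : X.carrier) : (p • m).ev x = p • m.ev x :=
  (Alg.lift fun _ => x).map_smul p m

/-- The component of a unary operation at a word. -/
noncomputable def coord (m : Endo δ) (w : List A) : Endo δ := (Alg.free δ PUnit).coord m w

theorem coord_ev (m : Endo δ) (w : List A) (x : X.carrier) :
    (m.coord w).ev x = X.coord (m.ev x) w :=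
  (Alg.lift fun _ => x).map_coord m w

/-- The unary operation with prescribed components at the letters. -/
noncomputable def node (f : A → Endo δ) : Endo δ := (Alg.free δ PUnit).node f

@[elab_as_elim]
theorem induction {Q : Endo δ → Prop} (m : Endo δ) (one : Q 1)
    (smul : ∀ (p : P) m, Q m → Q (p • m)) (proj : ∀ a m, Q m → Q (m.coord [a]))
    (node : ∀ f : A → Endo δ, (∀ a, Q (f a)) → Q (node f)) : Q m :=
  Alg.free_induction m (fun _ => one) smul proj node

theorem smul_mul (p : P) (m n : Endo δ) : p • m * n = p • (m * n) := smul_ev p m n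

theorem coord_mul (m n : Endo δ) (w : List A) : m.coord w * n = (m * n).coord w := coord_ev m w n

theorem coord_smul (p : P) (m : Endo δ) (w : List A) :
    (p • m).coord w = δ.resWord p w • m.coord (δ.actWord p w) :=
  Alg.coord_smul (X := Alg.free δ PUnit) p m w

theorem node_coord (f : A → Endo δ) (a : A) : (node f).coord [a] = f a := Alg.iso_node f a

theorem coord_one_mul (m : Endo δ) (w : List A) : (1 : Endo δ).coord w * m = m.coord w := by
  rw [coord_mul, one_mul]

theorem smul_one_mul (p : P) (m : Endo δ) : p • (1 : Endo δ) * m = p • m := by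
  rw [smul_mul, one_mul]

/-- The diagonal operation, which is a section of every projection. -/
noncomputable def diag : Endo δ := node fun _ => 1

theorem proj_mul_diag (a : A) : (1 : Endo δ).coord [a] * diag = 1 := by
  rw [coord_one_mul, diag, node_coord]

end Endo

end Endo

section

variable {P A : Type u} [Monoid P] [Nonempty A] {δ : SelfSimilarAction P A} {X : Alg δ}

open Clopen

namespace Alg

theorem Hom.map_condition {X Y : Alg δ} (f : Alg.Hom X Y) (b : Clopen A) (x y : X.carrier) :
    f.toFun (X.cond b x y) = Y.cond b (f.toFun x) (f.toFun y) :=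
  ext_clopen b
    (fun w hw => by rw [← f.map_coord, coord_cond_of_mem hw, coord_cond_of_mem hw, f.map_coord])
    (fun w hw => by
      rw [← f.map_coord, coord_cond_of_mem_compl hw, coord_cond_of_mem_compl hw, f.map_coord])

theorem coord_cond (b : Clopen A) (x y : X.carrier) (w : List A) :
    X.coord (X.cond b x y) w = X.cond (b.restrict w) (X.coord x w) (X.coord y w) :=
  ext_clopen (b.restrict w)
    (fun u hu => by
      rw [← coord_append, coord_cond_of_mem (mem_restrict.1 hu), coord_cond_of_mem hu,
        coord_append])
    (fun u hu => by
      rw [coord_cond_of_mem_compl hu, ← coord_append, ← coord_append]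
      rw [← restrict_compl] at hu
      rw [coord_cond_of_mem_compl (mem_restrict.1 hu)])

theorem smul_cond (p : P) (b : Clopen A) (x y : X.carrier) :
    p • X.cond b x y = X.cond (preimage δ p b) (p • x) (p • y) := by
  refine ext_clopen (preimage δ p b)
    (fun w hw => ?_) fun w hw => ?_
  · rw [coord_cond_of_mem hw]
    refine coord_eq_of_covers ((mem_preimage.1 hw).mono fun u hu => ?_)
    change X.coord _ _ = X.coord _ _
    rw [coord_smul, coord_smul, coord_cond_of_mem hu]
  · rw [coord_cond_of_mem_compl hw]
    rw [← preimage_compl] at hw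
    refine coord_eq_of_covers ((mem_preimage.1 hw).mono fun u hu => ?_)
    change X.coord _ _ = X.coord _ _
    rw [coord_smul, coord_smul, coord_cond_of_mem_compl hu]

end Alg

theorem clopen_cond (b c d : Clopen A) :
    (clopenAlg δ).cond b c d = (b ⊓ c ⊔ bᶜ ⊓ d : Clopen A) := by
  refine Alg.ext_clopen b (fun w hw => ?_) fun w hw => ?_
  · rw [Alg.coord_cond_of_mem hw, clopen_coord, clopen_coord, restrict_sup, restrict_inf,
      restrict_inf, restrict_compl, restrict_eq_top.2 hw]
    simp
  · rw [Alg.coord_cond_of_mem_compl hw, clopen_coord, clopen_coord, restrict_sup, restrict_inf,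
      restrict_inf, restrict_eq_top.2 hw, restrict_eq_bot hw]
    simp

namespace Endo

/-- The action of unary operations on clopens. -/
noncomputable def evClopen (m : Endo δ) (b : Clopen A) : Clopen A := m.ev (X := clopenAlg δ) b

theorem evClopen_coord (m : Endo δ) (w : List A) (b : Clopen A) :
    (m.coord w).evClopen b = (m.evClopen b).restrict w :=
  (coord_ev m w (X := clopenAlg δ) b).trans (clopen_coord _ w)

theorem restrict_evClopen_node (f : A → Endo δ) (b : Clopen A) (a : A) :
    ((node f).evClopen b).restrict [a] = (f a).evClopen b := by
  rw [← evClopen_coord, node_coord]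

theorem evClopen_smul (p : P) (m : Endo δ) (b : Clopen A) :
    (p • m).evClopen b = preimage δ p (m.evClopen b) :=
  smul_ev p m (X := clopenAlg δ) b

theorem evClopen_inf (m : Endo δ) (b c : Clopen A) :
    m.evClopen (b ⊓ c) = m.evClopen b ⊓ m.evClopen c := by
  induction m using Endo.induction with
  | one => rfl
  | smul p m ih => rw [evClopen_smul, evClopen_smul, evClopen_smul, ih, preimage_inf]
  | proj a m ih => rw [evClopen_coord, evClopen_coord, evClopen_coord, ih, restrict_inf]
  | node f ih =>
    refine ext_restrict fun a => ?_
    rw [restrict_inf, restrict_evClopen_node, restrict_evClopen_node, restrict_evClopen_node, ih]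

theorem evClopen_compl (m : Endo δ) (b : Clopen A) : m.evClopen bᶜ = (m.evClopen b)ᶜ := by
  induction m using Endo.induction with
  | one => rfl
  | smul p m ih => rw [evClopen_smul, evClopen_smul, ih, preimage_compl]
  | proj a m ih => rw [evClopen_coord, evClopen_coord, ih, restrict_compl]
  | node f ih =>
    refine ext_restrict fun a => ?_
    rw [restrict_compl, restrict_evClopen_node, restrict_evClopen_node, ih]

theorem evClopen_bot (m : Endo δ) : m.evClopen ⊥ = ⊥ := by
  have h := m.evClopen_inf ⊥ ⊥ᶜ
  rwa [evClopen_compl, inf_compl_eq_bot, inf_compl_eq_bot] at h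

/-- The action of a unary operation on clopens, as a homomorphism of Boolean algebras. -/
noncomputable def star (m : Endo δ) : BoundedLatticeHom (Clopen A) (Clopen A) where
  toFun := m.evClopen
  map_sup' b c := by
    rw [← compl_compl (b ⊔ c), compl_sup, evClopen_compl, evClopen_inf, evClopen_compl,
      evClopen_compl, compl_inf, compl_compl, compl_compl]
  map_inf' := m.evClopen_inf
  map_top' := by rw [← compl_bot, evClopen_compl, evClopen_bot]
  map_bot' := m.evClopen_bot

theorem star_apply (m : Endo δ) (b : Clopen A) : m.star b = m.evClopen b := rfl

/-- Unary operations preserve jointly dense families of clopens. -/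
theorem isCover_star (m : Endo δ) {Q : Set (Clopen A)} (hQ : IsCover Q) :
    Covers {w | ∃ b ∈ Q, w ∈ m.evClopen b} [] := by
  have hl : ∀ m : Endo δ, IsLeftIdeal {w | ∃ b ∈ Q, w ∈ m.evClopen b} :=
    fun m v _ ⟨b, hb, hw⟩ => ⟨b, hb, append_mem hw v⟩
  induction m using Endo.induction with
  | one => exact hQ []
  | smul p m ih =>
    refine (Covers.actWord (δ := δ) (p := p) ih).mono ?_
    rintro w ⟨b, hb, hw⟩
    refine ⟨b, hb, ?_⟩
    rw [evClopen_smul]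
    exact mem_preimage.2 (.mem hw)
  | proj a m ih =>
    refine (Covers.of_append (u := []) (w := [a]) (ih.append (hl m) [a])).mono ?_
    rintro w ⟨b, hb, hw⟩
    exact ⟨b, hb, by rwa [evClopen_coord]⟩
  | node f ih =>
    refine .step fun a => Covers.append_right (u := []) (w := [a]) ((ih a).mono ?_)
    rintro w ⟨b, hb, hw⟩
    refine ⟨b, hb, ?_⟩
    rwa [← mem_restrict, restrict_evClopen_node]

theorem isCoverPartition_star (m : Endo δ) {Q : Set (Clopen A)} (hQ : IsCoverPartition Q) :
    IsCoverPartition {d | d ≠ ⊥ ∧ ∃ b ∈ Q, m.star b = d} where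
  ne_bot _ h := h.1
  disjoint := by
    rintro _ ⟨_, b, hb, rfl⟩ _ ⟨_, c, hc, rfl⟩ hne
    rw [← map_inf, hQ.disjoint b hb c hc (by rintro rfl; exact hne rfl), map_bot]
  isCover w := by
    have h := (m.isCover_star hQ.isCover).append
      (fun v _ ⟨b, hb, hw⟩ => ⟨b, hb, append_mem hw v⟩) w
    rw [List.append_nil] at h
    refine h.mono ?_
    rintro v ⟨b, hb, hv⟩
    exact ⟨m.star b, ⟨fun h => not_mem_bot (h ▸ hv : v ∈ (⊥ : Clopen A)), b, hb, rfl⟩, hv⟩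

/-- The patching operation, as a function of the clopen as well, commutes with unary operations. -/
theorem ev_cond (m : Endo δ) (b : Clopen A) (x y : X.carrier) :
    m.ev (X.cond b x y) = X.cond (m.star b) (m.ev x) (m.ev y) := by
  induction m using Endo.induction with
  | one => rfl
  | smul p m ih =>
    rw [smul_ev, smul_ev, smul_ev, ih, Alg.smul_cond, star_apply, star_apply, evClopen_smul]
  | proj a m ih =>
    rw [coord_ev, coord_ev, coord_ev, ih, Alg.coord_cond, star_apply, star_apply, evClopen_coord]
  | node f ih =>
    refine X.iso.injective (funext fun a => ?_)
    change X.coord ((node f).ev (X.cond b x y)) [a] =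
      X.coord (X.cond ((node f).star b) ((node f).ev x) ((node f).ev y)) [a]
    rw [Alg.coord_cond, ← coord_ev, ← coord_ev, ← coord_ev, node_coord, ih, star_apply, star_apply,
      restrict_evClopen_node]

end Endo

variable (δ) in
/-- The matched pair classifying Nekrashevych algebras: clopens and unary operations. -/
noncomputable def matchedPair : MatchedPair (Clopen A) (Endo δ) where
  nondegenerate := bot_ne_top
  J := clopenTopology A
  bj := (Alg.free δ PUnit).bj
  star := Endo.star
  star_one _ := rfl
  star_mul m n b := Endo.mul_ev m n (X := clopenAlg δ) b
  star_mem m _ hQ := m.isCoverPartition_star hQ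
  cond_mul b m n p := (Alg.lift fun _ => p).map_condition b m n
  mul_cond m b n p := Endo.ev_cond m b (X := Alg.free δ PUnit) n p
  cond_star b m n c := ((Alg.lift (X := clopenAlg δ) fun _ => c).map_condition b m n).trans
    (clopen_cond b _ _)

/-! ### Nekrashevych algebras as algebras of the matched pair -/

variable (X) in
/-- A Nekrashevych algebra as an algebra of the matched pair. -/
@[reducible]
noncomputable def Alg.toBMSet : BMSet (matchedPair δ) where
  carrier := X.carrier
  action :=
    { smul := fun m x => m.ev x
      one_smul := fun _ => rfl
      mul_smul := fun m n x => Endo.mul_ev m n x }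
  bj := X.bj
  cond_smul b m n x := (Alg.lift fun _ => x).map_condition b m n
  smul_cond m b x y := m.ev_cond b x y

variable (δ) in
/-- The comparison functor. -/
noncomputable def comparison : Alg δ ⥤ BMSet (matchedPair δ) where
  obj X := X.toBMSet
  map {X Y} f :=
    { toFun := f.toFun
      map_smul := fun m x => Endo.map_ev f m x
      map_cond := f.map_condition
      map_glue := fun Q hQ hi x => Y.bj.eq_glue fun b => Alg.bj_rel.2 fun w hw =>
        (f.map_coord _ w).symm.trans <|
          (congrArg f.toFun (Alg.bj_rel.1 (X.bj.rel_glue hQ hi x b) w hw)).trans (f.map_coord _ w) }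

section

variable (Y : BMSet (matchedPair δ))

theorem rel_cone_iff {x y : X.carrier} {w : List A} :
    X.bj.Rel (cone w) x y ↔ X.coord x w = X.coord y w := by
  refine ⟨fun h => Alg.bj_rel.1 h w (mem_cone_self w), fun h => Alg.bj_rel.2 fun v hv => ?_⟩
  refine Alg.coord_eq_of_covers (Covers.mono hv ?_)
  rintro _ ⟨u, rfl⟩
  change X.coord _ _ = X.coord _ _
  rw [Alg.coord_append, Alg.coord_append, h]

theorem cone_cons_disjoint {a a' : A} (h : a ≠ a') (w : List A) :
    cone (a :: w) ⊓ cone (a' :: w) = ⊥ := by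
  have hl : ∀ w : List A, IsLeftIdeal {v | ∃ u, v = u ++ w} := by
    rintro w v _ ⟨u, rfl⟩
    exact ⟨v ++ u, by simp⟩
  refine eq_bot_iff_forall.2 fun v hv => Covers.false_of_empty (w := v) ?_
  refine (Covers.inter hv.1 hv.2 (hl _) (hl _)).mono ?_
  rintro _ ⟨⟨u, rfl⟩, ⟨u', h'⟩⟩
  exact h (by simpa using (List.append_inj' h' rfl).2)

theorem cone_nil : cone ([] : List A) = ⊤ := top_le_iff.1 fun v _ => .mem ⟨v, by simp⟩

theorem cone_ne_bot (w : List A) : cone w ≠ ⊥ := fun h =>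
  not_mem_bot (h ▸ mem_cone_self w : w ∈ (⊥ : Clopen A))

variable (A) in
theorem isCoverPartition_letters : IsCoverPartition (Set.range fun a : A => cone [a]) where
  ne_bot := by
    rintro _ ⟨a, rfl⟩
    exact cone_ne_bot _
  disjoint := by
    rintro _ ⟨a, rfl⟩ _ ⟨a', rfl⟩ hne
    exact cone_cons_disjoint (by rintro rfl; exact hne rfl) []
  isCover w := by
    have h : Covers {w | ∃ b ∈ Set.range fun a : A => cone [a], w ∈ b} [] :=
      .step fun a => .mem ⟨_, ⟨a, rfl⟩, mem_cone_self _⟩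
    simpa using h.append (isLeftIdeal_iUnion _) w

namespace Endo

theorem diag_mul_proj (a : A) :
    (matchedPair δ).bj.Rel (cone [a]) (diag * (1 : Endo δ).coord [a]) 1 := by
  refine rel_cone_iff.2 ?_
  change (diag * (1 : Endo δ).coord [a]).coord [a] = (1 : Endo δ).coord [a]
  rw [← coord_mul, diag, node_coord, one_mul]

theorem coord_one_star (w : List A) (b : Clopen A) :
    ((1 : Endo δ).coord w).star b = b.restrict w := evClopen_coord 1 w b

end Endo

/-- An element of an algebra of the matched pair is freely determined by its components at the
letters: it is patched from their images under the diagonal along the cones of the letters. -/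
theorem BMSet.proj_bijective :
    Function.Bijective fun (y : Y.carrier) (a : A) => (1 : Endo δ).coord [a] • y := by
  refine ⟨fun y y' h => ?_, fun φ => ?_⟩
  · refine BJStructure.eq_of_rel_parts (S := Y.bj) (isCoverPartition_letters A) ?_
    rintro _ ⟨a, rfl⟩
    have h1 := Y.rel_smul_left (Endo.diag_mul_proj a) y
    have h2 := Y.rel_smul_left (Endo.diag_mul_proj a) y'
    rw [one_smul, mul_smul] at h1 h2
    have h3 : (1 : Endo δ).coord [a] • y = (1 : Endo δ).coord [a] • y' := congrFun h a
    rw [h3] at h1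
    exact h1.symm.trans h2
  · have : Nonempty Y.carrier := ⟨φ (Classical.arbitrary A)⟩
    obtain ⟨z, hz⟩ := Y.bj.exists_rel_parts (isCoverPartition_letters A)
      fun b => (Endo.diag : Endo δ) • φ b.2.choose
    refine ⟨z, funext fun a => ?_⟩
    have hb : ∃ a', cone [a'] = cone [a] := ⟨a, rfl⟩
    -- The letter chosen for the cone of `a` is `a` itself.
    have ha : hb.choose = a := by
      by_contra hne
      have h1 := cone_cons_disjoint hne []
      rw [hb.choose_spec, inf_idem] at h1
      exact cone_ne_bot _ h1
    have h1 := Y.rel_smul_right ((1 : Endo δ).coord [a]) (hz ⟨cone [a], a, rfl⟩)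
    have h2 : (matchedPair δ).star ((1 : Endo δ).coord [a]) (cone [a]) = ⊤ :=
      (Endo.coord_one_star [a] _).trans (restrict_eq_top.2 (mem_cone_self _))
    rw [h2] at h1
    refine h1.eq.trans ?_
    rw [← mul_smul, Endo.proj_mul_diag, one_smul]
    exact congrArg φ ha

/-- An algebra of the matched pair as a Nekrashevych algebra. -/
@[reducible]
noncomputable def BMSet.toAlg : Alg δ where
  carrier := Y.carrier
  action :=
    { smul := fun p y => (p • (1 : Endo δ)) • y
      one_smul := fun y => by
        change ((1 : P) • (1 : Endo δ)) • y = y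
        rw [one_smul, one_smul]
      mul_smul := fun p q y => by
        change ((p * q) • (1 : Endo δ)) • y = (p • (1 : Endo δ)) • (q • (1 : Endo δ)) • y
        rw [← mul_smul, Endo.smul_one_mul, mul_smul] }
  iso := Equiv.ofBijective _ Y.proj_bijective
  iso_smul p y := funext fun a => by
    change (1 : Endo δ).coord [a] • (p • (1 : Endo δ)) • y =
      (δ.res p a • (1 : Endo δ)) • (1 : Endo δ).coord [δ.act a p] • y
    rw [← mul_smul, ← mul_smul, Endo.coord_one_mul, Endo.smul_one_mul, Endo.coord_smul]
    rfl

theorem BMSet.toAlg_ev (m : Endo δ) (y : Y.toAlg.carrier) :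
    m.ev y = m • (y : Y.carrier) :=
  Alg.free_hom_ext (f := Alg.lift fun _ => y) (g :=
    { toFun := fun m => (show Endo δ from m) • (y : Y.carrier)
      map_smul := fun p m => by
        change (p • (show Endo δ from m)) • (y : Y.carrier) =
          (p • (1 : Endo δ)) • (show Endo δ from m) • (y : Y.carrier)
        rw [← mul_smul, Endo.smul_one_mul]
      map_iso := fun m a => by
        change (1 : Endo δ).coord [a] • (show Endo δ from m) • (y : Y.carrier) =
          (show Endo δ from m).coord [a] • (y : Y.carrier)
        rw [← mul_smul, Endo.coord_one_mul] })
    (fun _ => (one_smul (Endo δ) (y : Y.carrier)).symm) m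

theorem BMSet.toAlg_rel {b : Clopen A} {x y : Y.carrier} (h : Y.bj.Rel b x y) :
    Y.toAlg.bj.Rel b x y := by
  have key : ∀ (z : Y.carrier) (w : List A),
      Y.toAlg.coord z w = (1 : Endo δ).coord w • z := fun z w => by
    rw [← BMSet.toAlg_ev, Endo.coord_ev, Endo.one_ev]
  refine Alg.bj_rel.2 fun w hw => ?_
  rw [key, key]
  have h1 := Y.rel_smul_right ((1 : Endo δ).coord w) h
  have h2 : (matchedPair δ).star ((1 : Endo δ).coord w) b = ⊤ :=
    (Endo.coord_one_star w _).trans (restrict_eq_top.2 hw)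
  rw [h2] at h1
  exact h1.eq

theorem BMSet.toAlg_cond (b : Clopen A) (x y : Y.carrier) :
    Y.toAlg.bj.cond b x y = Y.bj.cond b x y :=
  (BJStructure.eq_cond (Y.toAlg_rel (Y.bj.rel_cond b x y))
    (Y.toAlg_rel (Y.bj.rel_compl_cond b x y))).symm

theorem BMSet.toAlg_glue (Q : Set (Clopen A)) (hQ hi) (f : Q → Y.carrier) :
    Y.toAlg.bj.glue Q hQ hi f = Y.bj.glue Q hQ hi f :=
  (BJStructure.eq_glue fun b => Y.toAlg_rel (Y.bj.rel_glue hQ hi f b)).symm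

/-- The identity function is an isomorphism between an algebra of the matched pair and the one
attached to its Nekrashevych algebra. -/
noncomputable def BMSet.toAlgIso : (comparison δ).obj Y.toAlg ≅ Y where
  hom := ⟨id, fun m y => Y.toAlg_ev m y, Y.toAlg_cond, Y.toAlg_glue⟩
  inv := ⟨id, fun m y => (Y.toAlg_ev m y).symm, fun b x y => (Y.toAlg_cond b x y).symm,
    fun Q hQ hi f => (Y.toAlg_glue Q hQ hi f).symm⟩
  hom_inv_id := rfl
  inv_hom_id := rfl

end

instance : (comparison δ).Faithful where
  map_injective h := Alg.Hom.ext (congrArg BMSet.Hom.toFun h)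

instance : (comparison δ).Full where
  map_surjective {X Y} f := by
    let g : X.carrier → Y.carrier := f.toFun
    refine ⟨⟨g, fun p x => ?_, fun x a => ?_⟩, rfl⟩
    · have h : g (Endo.ev (p • (1 : Endo δ)) x) = Endo.ev _ (g x) := f.map_smul _ x
      rwa [Endo.smul_ev, Endo.smul_ev, Endo.one_ev, Endo.one_ev] at h
    · have h : g (Endo.ev ((1 : Endo δ).coord [a]) x) = Endo.ev _ (g x) := f.map_smul _ x
      rw [Endo.coord_ev, Endo.coord_ev] at h
      exact h.symm

instance : (comparison δ).EssSurj where
  mem_essImage Y := ⟨Y.toAlg, ⟨Y.toAlgIso⟩⟩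

instance : (comparison δ).IsEquivalence where

/-! ### Local invertibility for actions of groups -/

theorem isCoverPartition_cons (w : List A) :
    IsCoverPartition ({b | ∃ a, b = cone (a :: w)} ∪ {b | b ≠ ⊥ ∧ b = (cone w)ᶜ}) := by
  have hle : ∀ a, cone (a :: w) ≤ cone w := fun a => cone_le (append_mem (mem_cone_self w) [a])
  have hdisj : ∀ a, cone (a :: w) ⊓ (cone w)ᶜ = ⊥ := fun a =>
    le_bot_iff.1 ((inf_le_inf_right _ (hle a)).trans inf_compl_eq_bot.le)
  refine ⟨?_, ?_, fun v => ?_⟩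
  · rintro _ (⟨a, rfl⟩ | ⟨h, rfl⟩)
    exacts [cone_ne_bot _, h]
  · rintro _ (⟨a, rfl⟩ | ⟨_, rfl⟩) _ (⟨a', rfl⟩ | ⟨_, rfl⟩) hne
    · exact cone_cons_disjoint (by rintro rfl; exact hne rfl) w
    · exact hdisj a
    · rw [inf_comm]
      exact hdisj a'
    · exact absurd rfl hne
  · refine ((cone w).covers_compl v).bind fun u hu => ?_
    obtain hu | hu := hu
    · refine Covers.bind hu fun t ht => ?_
      obtain ⟨s, hs⟩ := ht
      rw [hs]
      refine Covers.append ?_ (isLeftIdeal_iUnion _) s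
      exact .step fun a => .mem ⟨cone (a :: w), .inl ⟨a, rfl⟩, mem_cone_self _⟩
    · exact .mem ⟨_, .inr ⟨fun h => not_mem_bot (h ▸ hu : _ ∈ (⊥ : Clopen A)), rfl⟩, hu⟩

/-- A closed ideal of clopens containing the cones of a dense family of words is everything. -/
theorem Idl.cone_mem {K : Idl (clopenTopology A)} {I : Set (List A)} (h : ∀ w ∈ I, cone w ∈ K)
    {w : List A} (hw : Covers I w) : cone w ∈ K := by
  induction hw with
  | mem hw => exact h _ hw
  | @step w _ ih =>
    refine K.closed (cone w) {b | ∃ a, b = cone (a :: w)}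
      ⟨⟨_, isCoverPartition_cons w, Set.subset_union_left⟩, ?_, fun c hc => ?_⟩ ?_
    · rintro _ ⟨a, rfl⟩
      exact cone_le (append_mem (mem_cone_self w) [a])
    · exact cone_le (c.isClosedIdeal.2 w fun a => hc ⟨a, rfl⟩ (mem_cone_self _))
    · rintro _ ⟨a, rfl⟩
      exact ih a

/-- For an action by a group, if `m_w = g • 1_v` then any `n` with `n_v = g⁻¹ • 1_w` is inverse to
`m` between the cones of `w` and `v`, and such `w` are dense. -/
theorem locallyInvertible_of_isUnit (h : ∀ p : P, IsUnit p) :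
    (matchedPair δ).LocallyInvertible := by
  intro m K hK
  rw [← cone_nil]
  refine Idl.cone_mem (fun w hw => hK _ ?_) (Alg.covers_reduced (S := PUnit) m)
  obtain ⟨q, v, _, hq⟩ := hw
  obtain ⟨g, rfl⟩ := h q
  have hm : m.coord w = (g : P) • (1 : Endo δ).coord v := hq
  obtain ⟨n, hn⟩ : ∃ n : Endo δ, n.coord v = (↑g⁻¹ : P) • (1 : Endo δ).coord w :=
    Alg.exists_coord_eq (X := Alg.free δ PUnit) v _
  refine ⟨n, cone v, rel_cone_iff.2 ?_, rel_cone_iff.2 ?_, cone_le (restrict_eq_top.1 ?_)⟩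
  · change (m * n).coord w = (1 : Endo δ).coord w
    rw [← Endo.coord_mul, hm, Endo.smul_mul, Endo.coord_one_mul, hn, ← mul_smul, Units.mul_inv,
      one_smul]
  · change (n * m).coord v = (1 : Endo δ).coord v
    rw [← Endo.coord_mul, hn, Endo.smul_mul, Endo.coord_one_mul, hm, ← mul_smul, Units.inv_mul,
      one_smul]
  · change (m.evClopen (cone v)).restrict w = ⊤
    rw [← Endo.evClopen_coord, hm, Endo.evClopen_smul, Endo.evClopen_coord]
    change preimage δ g ((cone v).restrict v) = ⊤
    rw [restrict_eq_top.2 (mem_cone_self v), preimage_top]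

theorem isGroupoidal_of_isUnit (h : ∀ p : P, IsUnit p) : IsGroupoidal (Alg.forget δ) :=
  ⟨Clopen A, Endo δ, inferInstance, inferInstance, matchedPair δ,
    ⟨(comparison δ).asEquivalence, ⟨Iso.refl _⟩⟩,
    (locallyInvertible_of_isUnit h).isLocalicGroupoid⟩

end

/-! ### Groupoidal theories: restrictions are densely invertible -/

section Groupoidal

variable {P A : Type u} [Monoid P] {δ : SelfSimilarAction P A}
  {B M : Type u} [BooleanAlgebra B] [Monoid M] {D : MatchedPair B M}

theorem ZeroDimTopology.exists_compl_part (J : ZeroDimTopology B) (b : B) :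
    ∃ Q ∈ J.parts, ∀ c ∈ Q, c = b ∨ c = bᶜ := by
  refine ⟨{x | x ≠ ⊥ ∧ (x = b ∨ x = bᶜ)}, J.finite_mem _ ?_ ⟨fun c hc => hc.1, ?_, ?_⟩,
    fun c hc => hc.2⟩
  · exact (Set.toFinite {b, bᶜ}).subset fun x hx => by simpa using hx.2
  · rintro c ⟨_, rfl | rfl⟩ e ⟨_, rfl | rfl⟩ h <;> simp at h ⊢
  · refine ⟨fun _ _ => le_top, fun t ht => ?_⟩
    have key : ∀ c, c = b ∨ c = bᶜ → c ≤ t := fun c hc => by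
      by_cases h : c = ⊥
      · simp [h]
      · exact ht ⟨h, hc⟩
    simpa using sup_le (key b (.inl rfl)) (key bᶜ (.inr rfl))

variable (δ D) in
/-- A presentation of the Nekrashevych algebras as the algebras of a matched pair: a full and
essentially surjective functor which is the identity on underlying sets, up to a natural
bijection. -/
structure Presentation where
  functor : Alg δ ⥤ BMSet D
  [full : functor.Full]
  [essSurj : functor.EssSurj]
  equiv : ∀ X : Alg δ, (functor.obj X).carrier ≃ X.carrier
  equiv_map : ∀ {X Y : Alg δ} (f : X ⟶ Y) (x : (functor.obj X).carrier),
    equiv Y ((functor.map f).toFun x) = f.toFun (equiv X x)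

namespace Presentation

variable (T : Presentation δ D)

theorem equiv_symm_map {X Y : Alg δ} (f : X ⟶ Y) (x : X.carrier) :
    (T.functor.map f).toFun ((T.equiv X).symm x) = (T.equiv Y).symm (f.toFun x) := by
  rw [Equiv.eq_symm_apply, T.equiv_map, Equiv.apply_symm_apply]

/-- Each `p` acts on Nekrashevych algebras as an element of the monoid of the matched pair. -/
theorem exists_smul_eq (p : P) : ∃ m : M, ∀ (X : Alg δ) (y : (T.functor.obj X).carrier),
    T.equiv X (m • y) = p • T.equiv X y := by
  have := T.full
  have := T.essSurj
  let R : Alg δ := T.functor.objPreimage (BMSet.regular D)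
  let i : T.functor.obj R ≅ BMSet.regular D := T.functor.objObjPreimageIso (BMSet.regular D)
  let x₀ : R.carrier := T.equiv R (i.inv.toFun (1 : M))
  refine ⟨i.hom.toFun ((T.equiv R).symm (p • x₀)), fun X y => ?_⟩
  obtain ⟨h, hh⟩ := T.functor.map_surjective
    (i.hom ≫ (show BMSet.regular D ⟶ _ from BMSet.orbit _ y))
  have hfun : ∀ z, (T.functor.map h).toFun z = (i.hom.toFun z : M) • y := fun z => by
    rw [hh]
    rfl
  have h1 : ∀ z, h.toFun z = T.equiv X ((i.hom.toFun ((T.equiv R).symm z) : M) • y) := fun z => by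
    rw [← hfun, T.equiv_map, Equiv.apply_symm_apply]
  have h2 : i.hom.toFun (i.inv.toFun (1 : M)) = (1 : M) :=
    congrFun (congrArg BMSet.Hom.toFun i.inv_hom_id) (1 : M)
  have h3 : h.toFun x₀ = T.equiv X y := by
    rw [h1, Equiv.symm_apply_apply]
    exact congrArg (T.equiv X) ((congrArg (· • y) h2).trans (one_smul M y))
  rw [← h1, h.map_smul, h3]

/-- The element `b` holds at the word `w` if, below `w`, the operation "if `b` then `x` else `y`"
is `x`. -/
def HoldsAt (b : B) (w : List A) : Prop :=
  ∀ (X : Alg δ) (x y : (T.functor.obj X).carrier),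
    X.coord (T.equiv X ((T.functor.obj X).bj.cond b x y)) w = X.coord (T.equiv X x) w

variable {T} {b c : B} {w : List A}

theorem HoldsAt.append (h : T.HoldsAt b w) (u : List A) : T.HoldsAt b (u ++ w) := fun X x y => by
  rw [Alg.coord_append, h X x y, Alg.coord_append]

theorem HoldsAt.coord_eq (h : T.HoldsAt b w) {X : Alg δ} {x y : (T.functor.obj X).carrier}
    (hxy : (T.functor.obj X).bj.Rel b x y) :
    X.coord (T.equiv X x) w = X.coord (T.equiv X y) w := by
  rw [← h X x y, show (T.functor.obj X).bj.cond b x y = y from hxy]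

theorem HoldsAt.mono (h : T.HoldsAt b w) (hbc : b ≤ c) : T.HoldsAt c w := fun X x y =>
  h.coord_eq (((T.functor.obj X).bj.rel_cond c x y).mono hbc)

theorem HoldsAt.inf (h : T.HoldsAt b w) (h' : T.HoldsAt c w) : T.HoldsAt (b ⊓ c) w :=
  fun X x y => by rw [(T.functor.obj X).bj.cond_inf, h, h']

variable (T) in
theorem holdsAt_top (w : List A) : T.HoldsAt ⊤ w := fun X x y => by
  rw [(T.functor.obj X).bj.cond_top]

variable (T) in
/-- Densely, one of the members of a given partition holds: the operation patching along the
partition is, densely, a multiple of a component of one of its arguments. -/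
theorem covers_holdsAt {Q : Set B} (hQ : Q ∈ D.J.parts) (w : List A) :
    Covers {w | ∃ c ∈ Q, T.HoldsAt c w} w := by
  classical
  let F := Alg.free δ Q
  have hne : Nonempty Q := by
    by_contra hne
    refine D.nondegenerate (le_bot_iff.1 ((D.J.isPartition Q hQ).isLUB.2 fun c hc => ?_)).symm
    exact (hne ⟨c, hc⟩).elim
  have hF : Nonempty (T.functor.obj F).carrier := ⟨(T.equiv F).symm (Alg.gen δ hne.some)⟩
  obtain ⟨t, ht⟩ := (T.functor.obj F).bj.exists_rel_parts hQ
    fun c => (T.equiv F).symm (Alg.gen δ c)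
  refine (Alg.covers_reduced' (T.equiv F t) w).mono ?_
  rintro v ⟨q, v', c, hv⟩
  refine ⟨c, c.2, fun X x y => ?_⟩
  -- Any patching of `f` along `Q` has, at `v`, the value prescribed by `f c`.
  have key : ∀ (f : Q → (T.functor.obj X).carrier) (z : (T.functor.obj X).carrier),
      (∀ d : Q, (T.functor.obj X).bj.Rel d z (f d)) →
      X.coord (T.equiv X z) v = q • X.coord (T.equiv X (f c)) v' := by
    intro f z hz
    let h : F ⟶ X := Alg.lift fun d => T.equiv X (f d)
    have h1 : (T.functor.map h).toFun t = z := by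
      refine BJStructure.eq_of_rel_parts (S := (T.functor.obj X).bj) hQ fun d hd => ?_
      have h2 := (T.functor.map h).map_rel (ht ⟨d, hd⟩)
      rw [T.equiv_symm_map] at h2
      have h3 : h.toFun (Alg.gen δ ⟨d, hd⟩) = T.equiv X (f ⟨d, hd⟩) := rfl
      rw [h3, Equiv.symm_apply_apply] at h2
      exact h2.trans (hz ⟨d, hd⟩).symm
    rw [← h1, T.equiv_map, ← h.map_coord, hv, h.map_smul, h.map_coord]
    rfl
  rw [key (fun d => if d = c then x else y) _ fun d => ?_, key (fun _ => x) x fun d => ?_]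
  · rw [if_pos rfl]
  · exact (T.functor.obj X).bj.rel_refl _ _
  · by_cases hd : d = c
    · rw [if_pos hd, hd]
      exact (T.functor.obj X).bj.rel_cond _ _ _
    · rw [if_neg hd]
      refine ((T.functor.obj X).bj.rel_compl_cond _ _ _).mono ?_
      rw [le_compl_iff_disjoint_right, disjoint_iff]
      exact (D.J.isPartition Q hQ).disjoint _ d.2 _ c.2 fun h => hd (Subtype.ext h)

theorem covers_holdsAt_or_compl (b : B) (w : List A) :
    Covers {w | T.HoldsAt b w ∨ T.HoldsAt bᶜ w} w := by
  obtain ⟨Q, hQ, h⟩ := D.J.exists_compl_part b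
  refine (T.covers_holdsAt hQ w).mono ?_
  rintro v ⟨c, hc, hv⟩
  obtain rfl | rfl := h c hc
  exacts [.inl hv, .inr hv]

variable [Nonempty A]

theorem not_holdsAt_bot : ¬T.HoldsAt ⊥ w := fun h => by
  -- Otherwise two constant functions on streams would agree below `w`.
  let X := streamAlg δ (ULift.{u} Bool)
  have h1 : ∀ x y : X.carrier, X.coord x w = X.coord y w := fun x y => by
    have := h.coord_eq ((T.functor.obj X).bj.rel_bot ((T.equiv X).symm x) ((T.equiv X).symm y))
    rwa [Equiv.apply_symm_apply, Equiv.apply_symm_apply] at this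
  obtain ⟨s⟩ : Nonempty (ℕ → A) := inferInstance
  have h2 := (streamAlg_coord (δ := δ) (fun _ => ULift.up.{u} true) w s 0).symm.trans
    ((congrFun (h1 (fun _ => ULift.up true) fun _ => ULift.up false) (s, 0)).trans
      (streamAlg_coord (δ := δ) (fun _ => ULift.up.{u} false) w s 0))
  simp at h2

theorem HoldsAt.inf_ne_bot (h : T.HoldsAt b w) (h' : T.HoldsAt c w) : b ⊓ c ≠ ⊥ := fun hbc =>
  not_holdsAt_bot (hbc ▸ h.inf h')

variable (T) in
/-- The closed ideal of the elements that hold only at words of a closed left ideal `K`. -/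
def idealOf {K : Set (List A)} (hK : IsClosedIdeal K) : Idl D.J where
  carrier := {b | ∀ w, T.HoldsAt b w → w ∈ K}
  bot_mem _ h := absurd h not_holdsAt_bot
  sup_mem b hb c hc w hw := by
    refine Covers.mem_of_isClosedIdeal
      ((covers_holdsAt_or_compl (T := T) b w).bind fun u hu => ?_) hK
    obtain hu | hu := hu
    · exact .mem (hb _ hu)
    refine (covers_holdsAt_or_compl (T := T) c (u ++ w)).bind fun v hv => ?_
    obtain hv | hv := hv
    · exact .mem (hc _ hv)
    · refine absurd ?_ (((hw.append u).append v).inf_ne_bot ((hu.append v).inf hv))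
      rw [← compl_sup, inf_compl_eq_bot]
  lower b hb c hc w hw := hb w (hw.mono hc)
  closed b Q := by
    rintro ⟨⟨R, hR, hQR⟩, hlub⟩ hQ w hw
    refine Covers.mem_of_isClosedIdeal ((T.covers_holdsAt hR w).bind fun u hu => ?_) hK
    obtain ⟨c, hc, hu⟩ := hu
    by_cases hcQ : c ∈ Q
    · exact .mem (hQ hcQ _ hu)
    · refine absurd ?_ ((hw.append u).inf_ne_bot hu)
      have h1 : b ≤ cᶜ := hlub.2 fun d hd => by
        rw [le_compl_iff_disjoint_right, disjoint_iff]
        exact (D.J.isPartition R hR).disjoint d (hQR hd) c hc (by rintro rfl; exact hcQ hd)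
      exact (le_compl_iff_disjoint_right.1 h1).eq_bot

/-- If `n` is right inverse over `b` to the action `m` of `p`, then `p|_w` has a right inverse for a
dense family of words `w` at which `b` holds. -/
theorem covers_rightInverse (hδ : δ.Faithful) {p : P} {m n : M}
    (hm : ∀ (X : Alg δ) (y : (T.functor.obj X).carrier), T.equiv X (m • y) = p • T.equiv X y)
    (hn : D.bj.Rel b (m * n) 1) (hw : T.HoldsAt b w) :
    Covers {w | ∃ q, δ.resWord p w * q = 1} w := by
  let F := Alg.free δ PUnit.{u + 1}
  let t : F.carrier := T.equiv F (n • (T.equiv F).symm (Alg.gen δ PUnit.unit))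
  refine (Covers.actWord (Alg.covers_reduced' t (δ.actWord p w))).bind fun u hu => .mem ?_
  obtain ⟨q, v, s, hq⟩ := hu
  let X := streamAlg δ ((ℕ → A) × ℤ)
  let y := (T.equiv X).symm genericStream
  let h : F ⟶ X := Alg.lift fun _ => genericStream
  have h1 : h.toFun t = T.equiv X (n • y) := by
    rw [← T.equiv_map, (T.functor.map h).map_smul, T.equiv_symm_map]
    rfl
  have h2 := (hw.append u).coord_eq ((T.functor.obj X).rel_smul_left hn y)
  rw [one_smul, mul_smul, hm, Alg.coord_smul, ← h1, ← h.map_coord, hq, h.map_smul, h.map_coord,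
    ← mul_smul, Equiv.apply_symm_apply] at h2
  refine ⟨q, hδ _ _ (genericStream_separates (v := v) (v' := u ++ w) ?_).2⟩
  rw [one_smul]
  exact h2

/-- The `b` over which `p` has a right inverse generate the unit ideal, and they lie in the ideal of
those holding only in the closure of the words `w` with `p|_w` right invertible. -/
theorem covers_rightInverse_of_isLocalicGroupoid (T : Presentation δ D) (hD : D.IsLocalicGroupoid)
    (hδ : δ.Faithful) (p : P) (w : List A) : Covers {w | ∃ q, δ.resWord p w * q = 1} w := by
  have hl : IsLeftIdeal {w | ∃ q, δ.resWord p w * q = 1} := by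
    rintro u w ⟨q, hq⟩
    refine ⟨δ.resWord q (δ.actWord (δ.resWord p w) u), ?_⟩
    rw [δ.resWord_append, ← δ.resWord_mul, hq, δ.resWord_one]
  obtain ⟨m, hm⟩ := T.exists_smul_eq p
  have h := hD.exists_right_inverse m (T.idealOf hl.isClosedIdeal_covers) (by
    rintro b ⟨n, hn⟩ w hw
    exact covers_rightInverse hδ hm hn hw)
  exact h w (T.holdsAt_top w)

end Presentation

/-- If all restrictions are densely right invertible, they are densely invertible: a right inverse
of `p|_w` has, densely, a right inverse too. -/
theorem covers_isUnit {δ : SelfSimilarAction P A}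
    (h : ∀ p w, Covers {w | ∃ q, δ.resWord p w * q = 1} w) (p : P) (w : List A) :
    Covers {w | IsUnit (δ.resWord p w)} w := by
  refine (h p w).bind fun u hu => ?_
  obtain ⟨q, hq⟩ := hu
  refine Covers.append_right (u := []) (w := u ++ w)
    ((Covers.actWord (δ := δ) (p := δ.resWord p (u ++ w)) (w := []) (h q _)).mono ?_)
  rintro v ⟨r, hr⟩
  have h1 := δ.resWord_mul (δ.resWord p (u ++ w)) q v
  rw [hq, δ.resWord_one, ← δ.resWord_append] at h1
  change IsUnit (δ.resWord p (v ++ (u ++ w)))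
  have h2 := left_inv_eq_right_inv h1.symm hr
  rw [h2] at h1 ⊢
  exact ⟨⟨r, _, h1.symm, hr⟩, rfl⟩

theorem IsGroupoidal.covers_isUnit [Nonempty A] (hδ : δ.Faithful) (h : IsGroupoidal (Alg.forget δ))
    (p : P) (w : List A) : Covers {w | IsUnit (δ.resWord p w)} w := by
  obtain ⟨B, M, _, _, D, ⟨E, ⟨i⟩⟩, hD⟩ := h
  let T : Presentation δ D :=
    { functor := E.functor
      equiv := fun X => (i.app X).toEquiv
      equiv_map := fun f x => ConcreteCategory.congr_hom (i.hom.naturality f) x }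
  exact Nekrashevych.covers_isUnit (T.covers_rightInverse_of_isLocalicGroupoid hD hδ) p w

end Groupoidal

/-! ### Extending actions from the group of invertible elements -/

section Extension

variable {P A : Type u} [Monoid P] {δ : SelfSimilarAction P A}

theorem Alg.toUnits_coord (X : Alg δ) (x : X.carrier) (w : List A) :
    ((Alg.toUnits δ).obj X).coord x w = X.coord x w := by
  induction w with
  | nil => rfl
  | cons a w ih => exact congrArg (X.iso · a) ih

theorem SelfSimilarAction.isLeftIdeal_isUnit (δ : SelfSimilarAction P A) (p : P) :
    IsLeftIdeal {w | IsUnit (δ.resWord p w)} := fun u w hw => by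
  change IsUnit (δ.resWord p (u ++ w))
  rw [δ.resWord_append]
  exact δ.isUnit_resWord hw u

instance : (Alg.toUnits δ).Faithful where
  map_injective h := Alg.Hom.ext (congrArg Alg.Hom.toFun h :)

theorem Alg.toUnits_full (hd : ∀ p w, Covers {w | IsUnit (δ.resWord p w)} w) :
    (Alg.toUnits δ).Full where
  map_surjective {X Y} f := by
    let g : X.carrier → Y.carrier := f.toFun
    have hc : ∀ x w, g (X.coord x w) = Y.coord (g x) w := fun x w => by
      rw [← toUnits_coord, ← toUnits_coord]
      exact f.map_coord x w
    refine ⟨⟨g, fun p x => ext_of_covers ((hd p []).mono ?_), f.map_iso⟩, rfl⟩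
    rintro w ⟨k, hk⟩
    change Y.coord _ _ = Y.coord _ _
    rw [← hc, coord_smul, coord_smul, ← hc, ← hk]
    exact f.map_smul k _

theorem Alg.toUnits_injective (hd : ∀ p w, Covers {w | IsUnit (δ.resWord p w)} w) :
    Function.Injective (Alg.toUnits δ).obj := by
  rintro @⟨T, a₁, i₁, h₁⟩ @⟨T', a₂, i₂, h₂⟩ h
  obtain ⟨hT, ha, hi⟩ := Alg.mk.inj h
  subst hT
  obtain rfl : i₁ = i₂ := eq_of_heq hi
  have ha := eq_of_heq ha
  suffices a₁ = a₂ by subst this; rfl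
  let X₁ : Alg δ := @Alg.mk P A _ δ T a₁ i₁ h₁
  let X₂ : Alg δ := @Alg.mk P A _ δ T a₂ i₁ h₂
  have hc : ∀ (x : T) w, X₁.coord x w = X₂.coord x w := fun x w => by
    induction w with
    | nil => rfl
    | cons a w ih => exact congrArg (i₁ · a) ih
  have hu : ∀ (g : Pˣ) (x : T), a₁.smul g x = a₂.smul g x := fun g x =>
    congrArg (fun a : MulAction Pˣ T => a.smul g x) ha
  refine MulAction.ext (funext fun p => funext fun x => ?_)
  refine ext_of_covers (X := X₁) ((hd p []).mono ?_)
  rintro w ⟨k, hk⟩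
  have e₁ : X₁.coord (a₁.smul p x) w = a₁.smul k (X₁.coord x (δ.actWord p w)) := by
    rw [hk]
    exact coord_smul (X := X₁) p x w
  have e₂ : X₂.coord (a₂.smul p x) w = a₂.smul k (X₂.coord x (δ.actWord p w)) := by
    rw [hk]
    exact coord_smul (X := X₂) p x w
  exact e₁.trans ((hu k _).trans ((congrArg (a₂.smul k) (hc _ _)).trans
    (e₂.symm.trans (hc _ _).symm)))

/-- In an algebra for the units, the value of `p` at `x` is patched from the `p|_w • x_{w ⋆ p}` with
`p|_w` invertible. -/
theorem Alg.exists_extend (hd : ∀ p w, Covers {w | IsUnit (δ.resWord p w)} w)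
    (Y : Alg δ.units) (p : P) (x : Y.carrier) :
    ∃ z, ∀ w (g : Pˣ), δ.resWord p w = g → Y.coord z w = g • Y.coord x (δ.actWord p w) := by
  classical
  let s : List A → Y.carrier := fun w =>
    if h : IsUnit (δ.resWord p w) then h.unit • Y.coord x (δ.actWord p w) else x
  have hs : ∀ w (g : Pˣ), δ.resWord p w = g → s w = g • Y.coord x (δ.actWord p w) := by
    intro w g hg
    have h : IsUnit (δ.resWord p w) := ⟨g, hg.symm⟩
    have h' : h.unit = g := Units.ext hg
    simp only [s, dif_pos h, h']
  obtain ⟨z, hz⟩ := exists_patch (δ.isLeftIdeal_isUnit p) s (fun w hw a => by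
    obtain ⟨g, hg⟩ := hw
    have hg' : δ.resWord p (a :: w) = (δ.units.res g a : Pˣ) := congrArg (δ.res · a) hg.symm
    rw [hs w g hg.symm, hs _ _ hg', Y.iso_smul]
    change δ.units.res g a • Y.coord x (δ.act a g :: δ.actWord p w) = _
    rw [hg]
    rfl) (hd p [])
  refine ⟨z, fun w g hg => ?_⟩
  rw [← hs w g hg]
  simpa using hz w ⟨g, by simpa using hg.symm⟩

/-- The patched values define an action, since the identities to be checked hold at the dense family
of words where all restrictions involved are invertible. -/
theorem Alg.toUnits_surjective (hd : ∀ p w, Covers {w | IsUnit (δ.resWord p w)} w) :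
    Function.Surjective (Alg.toUnits δ).obj := by
  intro Y
  choose sm hsm using Alg.exists_extend hd Y
  have hunit : ∀ (g : Pˣ) x, sm g x = g • x := fun g x => hsm g x [] g rfl
  have hmul : ∀ p q x, sm (p * q) x = sm p (sm q x) := by
    intro p q x
    refine ext_of_covers (((hd p []).inter (Covers.actWord (p := p) (hd q (δ.actWord p [])))
      (δ.isLeftIdeal_isUnit p) (δ.isLeftIdeal_preimage (δ.isLeftIdeal_isUnit q) p)).mono ?_)
    rintro w ⟨⟨g, hg⟩, ⟨k, hk⟩⟩
    change Y.coord _ _ = Y.coord _ _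
    rw [hsm p _ w g hg.symm, hsm q x _ k hk.symm, ← mul_smul, ← δ.actWord_mul]
    exact hsm (p * q) x w (g * k) (by rw [δ.resWord_mul, Units.val_mul, hg, hk])
  have hiso : ∀ p x a, Y.iso (sm p x) a = sm (δ.res p a) (Y.iso x (δ.act a p)) := by
    intro p x a
    refine ext_of_covers ((Covers.of_append (u := []) (w := [a]) (hd p [a])).mono ?_)
    rintro w ⟨g, hg⟩
    have hg' : δ.resWord (δ.res p a) w = g := by
      rw [hg, δ.resWord_append]
      rfl
    change Y.coord _ _ = Y.coord _ _
    rw [hsm _ _ w g hg']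
    refine (coord_append (sm p x) w [a]).symm.trans ?_
    rw [hsm p x (w ++ [a]) g hg.symm, δ.actWord_append, coord_append]
    rfl
  let X : Alg δ :=
    { carrier := Y.carrier
      action :=
        { smul := sm
          one_smul := fun x => (hunit 1 x).trans (one_smul _ x)
          mul_smul := hmul }
      iso := Y.iso
      iso_smul := fun p x => funext fun a => hiso p x a }
  refine ⟨X, ?_⟩
  obtain @⟨T, a, i, h⟩ := Y
  have ha : ((Alg.toUnits δ).obj X).action = a :=
    MulAction.ext (funext fun g => funext fun x => hunit g x)
  have key : ∀ (a' : MulAction Pˣ T) (h' : ∀ (p : Pˣ) x, i (a'.smul p x) = p • i x), a' = a →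
      @Alg.mk Pˣ A _ δ.units T a' i h' = @Alg.mk Pˣ A _ δ.units T a i h := by
    rintro a' h' rfl
    rfl
  exact key _ _ ha

theorem Alg.toUnits_isIso (hd : ∀ p w, Covers {w | IsUnit (δ.resWord p w)} w) :
    (Alg.toUnits δ).IsIso where
  full := Alg.toUnits_full hd
  bijective_obj := ⟨Alg.toUnits_injective hd, Alg.toUnits_surjective hd⟩

end Extension

/-- Groupoidality passes from the algebras of the units, where it always holds. -/
theorem isGroupoidal_of_isIso {P A : Type u} [Monoid P] [Nonempty A] {δ : SelfSimilarAction P A}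
    (h : (Alg.toUnits δ).IsIso) : IsGroupoidal (Alg.forget δ) := by
  obtain ⟨B, M, iB, iM, D, ⟨E, ⟨i⟩⟩, hD⟩ :=
    isGroupoidal_of_isUnit (δ := δ.units) fun g => Group.isUnit g
  refine ⟨B, M, iB, iM, D, ⟨(Alg.toUnits δ).asEquivalence.trans E, ⟨?_⟩⟩, hD⟩
  exact Functor.isoWhiskerLeft (Alg.toUnits δ) i

end Nekrashevych

theorem proposition49 {P A : Type u} [Monoid P] [Nonempty A]
    (δ : Nekrashevych.SelfSimilarAction P A) (hδ : δ.Faithful) :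
    List.TFAE [
      Nekrashevych.IsGroupoidal (Nekrashevych.Alg.forget δ),
      ∀ p : P, ∃ I : Set (List A), Nekrashevych.IsDenseIdeal I ∧
        ∀ w ∈ I, IsUnit (δ.resWord p w),
      (Nekrashevych.Alg.toUnits δ).IsIso] := by
  tfae_have 1 → 2 := fun h p => ⟨{w | IsUnit (δ.resWord p w)},
    Nekrashevych.isDenseIdeal_iff.2 ⟨δ.isLeftIdeal_isUnit p, h.covers_isUnit hδ p⟩, fun _ hw => hw⟩
  tfae_have 2 → 3 := fun h => Nekrashevych.Alg.toUnits_isIso fun p w => by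
    obtain ⟨I, hI, hp⟩ := h p
    exact ((Nekrashevych.isDenseIdeal_iff.1 hI).2 w).mono hp
  tfae_have 3 → 1 := Nekrashevych.isGroupoidal_of_isIso
  tfae_finish
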